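/- Let $\Omega=\Omega_1\times\cdots\times\Omega_n$ be a product of measurable spaces, $[n]=\{1,\dots,n\}$, and let $X=(X_1,\dots,X_n)$ be a random vector with independent components taking values in $\Omega$. For $x,y\in\Omega$ and $W\subseteq[n]$ let $x\triangleright_W y$ be the vector whose $j$-th component is $y_j$ if $j\in W$ and $x_j$ if $j\notin W$. For a bounded measurable $f:\Omega\to\mathbb{C}$, $V\subseteq[n]$ and $k\in[n]$, define $$\overline{\Delta}_V(f,X)=\sup_{y\in\Omega}\Bigl|\mathbb{E}\sum_{W\subseteq V}(-1)^{|W|}f(X\triangleright_W y)\Bigr|,\qquad S_k(f,X)=\max_{j\in[n]}\ \sum_{V\subseteq[n]:\,|V|=k,\ j\in V}\overline{\Delta}_V(f,X).$$ The cumulants $\kappa_r(Z)$, $r\ge1$, of a bounded complex random variable $Z$ are defined by the identity of formal power series $\sum_{j\ge0}\frac{\mathbb{E}Z^j}{j!}t^j=\exp\Bigl(\sum_{r\ge1}\frac{\kappa_r(Z)}{r!}t^r\Bigr)$. Theorem 1.2. Let $m>0$ be an integer and $\alpha\ge0$. Suppose that $f:\Omega\to\mathbb{C}$ is bounded and measurable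 and that $$\sum_{k=t}^{n}e^{3\alpha k/2}\,2^t\binom{k-1}{t-1}S_k(f,X)\le\alpha\le\frac1{100}\qquad\text{for all }t\in\{1,\dots,m\}.$$ Then there is $\delta\in\mathbb{C}$ with $|\delta|\le e^{(100\alpha)^{m+1}}-1$ such that $$\mathbb{E}\,e^{f(X)}=(1+\delta)^n\exp\Bigl(\sum_{r=1}^{m}\frac{\kappa_r(f(X))}{r!}\Bigr).$$ Furthermore, for $2\le r\le m$, $$|\kappa_r(f(X))|\le n\,\frac{(r-1)!}{50r}\,(80\alpha)^r.$$ -/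

import Mathlib

open MeasureTheory ProbabilityTheory

noncomputable section

/-- The exponential generating series `∑ⱼ E[W ^ j] / j! · t ^ j` of the moments of a complex random
variable `W`, as a formal power series in `t`, i.e. the formal expansion of `E exp (t W)`. -/
def momentSeries {S : Type*} [MeasurableSpace S] (P : Measure S) (W : S → ℂ) : PowerSeries ℂ :=
  PowerSeries.mk fun j => (∫ s, W s ^ j ∂P) / (Nat.factorial j : ℂ)

/-- The `r`-th cumulant of a bounded complex random variable `W`, defined by the formal identity
`∑ⱼ E[W ^ j] / j! · t ^ j = exp (∑ᵣ κᵣ / r! · t ^ r)`: it is `r!` times the coefficient of `t ^ r`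
in the formal logarithm of the moment series (whose constant term is `1`). -/
def cumulant {S : Type*} [MeasurableSpace S] (P : Measure S) (W : S → ℂ) (r : ℕ) : ℂ :=
  (Nat.factorial r : ℂ) * PowerSeries.coeff r (PowerSeries.logOf (momentSeries P W))

/-- `x ▷_V y`: the vector with `j`-th component `y j` if `j ∈ V`, and `x j` if `j ∉ V`. -/
def replaceOn {n : ℕ} {Ω : Fin n → Type*} (V : Finset (Fin n)) (x y : ∀ i, Ω i) : ∀ i, Ω i :=
  fun j => if j ∈ V then y j else x j

/-- The averaged mixed difference
`sup_y |E ∑_{W ⊆ V} (-1) ^ |W| f (X ▷_W y)|`, the supremum being over all points `y` of the product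
domain. For bounded `f` the set of values is bounded, so this is the genuine supremum. -/
def avgDiff {S : Type*} [MeasurableSpace S] (P : Measure S) {n : ℕ} {Ω : Fin n → Type*}
    (X : ∀ i, S → Ω i) (f : (∀ i, Ω i) → ℂ) (V : Finset (Fin n)) : ℝ :=
  ⨆ y : ∀ i, Ω i,
    ‖∫ s, ∑ W ∈ V.powerset, (-1 : ℂ) ^ W.card * f (replaceOn W (fun i => X i s) y) ∂P‖

/-- `S_k`: the maximum over the coordinates `j` of the sum of the averaged mixed differences over
all `k`-element sets of coordinates that contain `j`. -/
def maxRowSum {S : Type*} [MeasurableSpace S] (P : Measure S) {n : ℕ} {Ω : Fin n → Type*}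
    (X : ∀ i, S → Ω i) (f : (∀ i, Ω i) → ℂ) (k : ℕ) : ℝ :=
  ⨆ j : Fin n, ∑ V ∈ (Finset.univ.powersetCard k).filter (fun V => j ∈ V), avgDiff P X f V

end

/-! The function `f` is split into its Hoeffding components, `f = ∑ V, g V`, where `g V` depends only
on the coordinates in `V` and is bounded by the averaged mixed difference at `V`
(`sum_hoeffdingComponent`, `norm_hoeffdingComponent_le`). The hypotheses then say that `g` is a weak
many-body interaction, and `log E exp (z * f)` is estimated as in a high-temperature expansion. All
quantities are formal power series in `z`, so that the cumulants are coefficients of the logarithm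
from the outset.

Adding the terms `g V` one at a time multiplies the partition series by factors `1 + u`, and `u` is an
average of `exp (z * g V) - 1` times the ratio of two partition series, one of them with the
coordinates in `V` frozen (`IsInteraction.partitionSeries_insert_ratio`). That ratio only involves the
terms already present that meet `V`, so it is a product of factors `1 + u` for smaller families, and
induction closes the loop (`freeze_ratio_le`, `insert_ratio_le`, `ratioBound`).

The hypotheses provide only `m` binomial moments of the sizes of the sets `V`, and exponential moments
of rate of order `α`. This is matched by the norm `NormLE R q`, which weighs the coefficient of `z ^ r`
by `R ^ min r q` with `R` of order `1 / α`. A factor without constant term uses up one degree of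
truncation (`NormLE.mul_succ`), so a product of `k` factors `1 + p` costs a binomial sum truncated at
`q`, times an exponential of `k` that is measured at `q = 0` only (`NormLE.ratio_filter_disjoint`).
Summing over all `V` with weight `1 / |V|` for each of its elements gains one more degree, so that `m`
moments suffice for the norm with `q = m + 1` (`IsSmall.sum_weightTop_le`). The resulting bound
`NormLE R (m + 1) L (n / 19)` for the logarithm `L` contains both the estimates of the cumulants and
the estimate of all terms beyond the `m`-th, and evaluation at `z = 1` is legitimate because
everything converges absolutely (`PowerSeries.exp_coeffSum_logOf`). -/

/-! ### Truncated weighted `ℓ¹` bounds for formal power series -/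

/-- `NormLE R q g c` says that the weighted `ℓ¹` norm `∑ᵣ R ^ min r q * ‖gᵣ‖` of the power series `g`
is at most `c`. It is encoded through partial sums, so that no summability has to be assumed. For
`R ≥ 1` the weight is submultiplicative, so this is a Banach algebra norm; it weighs the
coefficients of degree up to `q` geometrically and all later ones only by the constant `R ^ q`. -/
def NormLE (R : ℝ) (q : ℕ) (g : PowerSeries ℂ) (c : ℝ) : Prop :=
  ∀ N, ∑ r ∈ Finset.range N, R ^ min r q * ‖PowerSeries.coeff r g‖ ≤ c

namespace NormLE

variable {R : ℝ} {q : ℕ} {g h : PowerSeries ℂ} {c d : ℝ}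

lemma nonneg (hg : NormLE R q g c) : 0 ≤ c := by simpa using hg 0

lemma mono (hg : NormLE R q g c) (hcd : c ≤ d) : NormLE R q g d := fun N => (hg N).trans hcd

lemma of_le (hR : 1 ≤ R) {p : ℕ} (hpq : p ≤ q) (hg : NormLE R q g c) : NormLE R p g c := by
  intro N
  refine le_trans (Finset.sum_le_sum fun r _ => ?_) (hg N)
  gcongr

lemma one_iff : NormLE 1 q g c ↔ NormLE R 0 g c := by
  simp [NormLE]

lemma add (hg : NormLE R q g c) (hh : NormLE R q h d) (hR : 1 ≤ R) : NormLE R q (g + h) (c + d) := by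
  intro N
  refine le_trans ?_ (add_le_add (hg N) (hh N))
  rw [← Finset.sum_add_distrib]
  refine Finset.sum_le_sum fun r _ => ?_
  rw [← mul_add, map_add]
  gcongr
  exact norm_add_le _ _

lemma neg (hg : NormLE R q g c) : NormLE R q (-g) c := by
  intro N
  simpa using hg N

lemma one : NormLE R q 1 1 := by
  intro N
  cases N with
  | zero => simp
  | succ N =>
    rw [Finset.sum_range_succ']
    simp [PowerSeries.coeff_one]

lemma zero : NormLE R q 0 0 := by
  intro N
  simp

lemma coeff_le (hg : NormLE R q g c) (hR : 0 ≤ R) (r : ℕ) :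
    R ^ min r q * ‖PowerSeries.coeff r g‖ ≤ c :=
  (Finset.single_le_sum (f := fun r => R ^ min r q * ‖PowerSeries.coeff r g‖)
    (fun i _ => by positivity) (Finset.self_mem_range_succ r)).trans (hg (r + 1))

/-- Truncated Cauchy product, for three weights that are compatible on the support. -/
lemma sum_mul_le {R : ℝ} (hR : 0 ≤ R) {p q s : ℕ} (g h : PowerSeries ℂ) (N : ℕ)
    (hw : ∀ a b, PowerSeries.coeff a g ≠ 0 →
      R ^ min (a + b) s ≤ R ^ min a p * R ^ min b q) :
    ∑ r ∈ Finset.range N, R ^ min r s * ‖PowerSeries.coeff r (g * h)‖ ≤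
      (∑ a ∈ Finset.range N, R ^ min a p * ‖PowerSeries.coeff a g‖) *
        ∑ b ∈ Finset.range N, R ^ min b q * ‖PowerSeries.coeff b h‖ := by
  have h1 : ∀ r ∈ Finset.range N, R ^ min r s * ‖PowerSeries.coeff r (g * h)‖ ≤
      ∑ x ∈ Finset.HasAntidiagonal.antidiagonal r, (R ^ min x.1 p * ‖PowerSeries.coeff x.1 g‖) *
        (R ^ min x.2 q * ‖PowerSeries.coeff x.2 h‖) := by
    intro r _
    rw [PowerSeries.coeff_mul]
    refine (mul_le_mul_of_nonneg_left (norm_sum_le _ _) (by positivity)).trans ?_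
    rw [Finset.mul_sum]
    refine Finset.sum_le_sum fun x hx => ?_
    rw [Finset.HasAntidiagonal.mem_antidiagonal] at hx
    by_cases h0 : PowerSeries.coeff x.1 g = 0
    · simp [h0]
    · have := hw x.1 x.2 h0
      rw [hx] at this
      rw [norm_mul]
      calc _ ≤ (R ^ min x.1 p * R ^ min x.2 q) *
            (‖PowerSeries.coeff x.1 g‖ * ‖PowerSeries.coeff x.2 h‖) := by gcongr
        _ = _ := by ring
  refine (Finset.sum_le_sum h1).trans ?_
  rw [Finset.sum_mul_sum, ← Finset.sum_product']
  set F : ℕ × ℕ → ℝ := fun x => (R ^ min x.1 p * ‖PowerSeries.coeff x.1 g‖) *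
    (R ^ min x.2 q * ‖PowerSeries.coeff x.2 h‖) with hF
  have hF0 : ∀ x, 0 ≤ F x := fun x => by positivity
  have h2 : ∀ r ∈ Finset.range N, ∑ x ∈ Finset.HasAntidiagonal.antidiagonal r, F x =
      ∑ x ∈ (Finset.range N ×ˢ Finset.range N) with x.1 + x.2 = r, F x := by
    intro r hr
    refine Finset.sum_congr ?_ fun _ _ => rfl
    ext x
    simp only [Finset.HasAntidiagonal.mem_antidiagonal, Finset.mem_filter, Finset.mem_product, Finset.mem_range]
      at hr ⊢
    omega
  rw [Finset.sum_congr rfl h2]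
  exact Finset.sum_fiberwise_le_sum_of_sum_fiber_nonneg fun _ _ =>
    Finset.sum_nonneg fun x _ => hF0 x

lemma mul_aux {p q s : ℕ} (hR : 0 ≤ R) (hg : NormLE R p g c) (hh : NormLE R q h d)
    (hw : ∀ a b, PowerSeries.coeff a g ≠ 0 →
      R ^ min (a + b) s ≤ R ^ min a p * R ^ min b q) : NormLE R s (g * h) (c * d) := fun N =>
  (sum_mul_le hR g h N hw).trans (mul_le_mul (hg N) (hh N)
    (Finset.sum_nonneg fun _ _ => by positivity) hg.nonneg)

lemma mul (hg : NormLE R q g c) (hh : NormLE R q h d) (hR : 1 ≤ R) :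
    NormLE R q (g * h) (c * d) := by
  refine mul_aux (by linarith) hg hh fun a b _ => ?_
  rw [← pow_add]
  exact pow_le_pow_right₀ hR (by omega)

/-- If `g` has no constant term, then the other factor needs to be measured only at one truncation
degree less. -/
lemma mul_succ (hg : NormLE R (q + 1) g c) (h0 : PowerSeries.constantCoeff g = 0)
    (hh : NormLE R q h d) (hR : 1 ≤ R) : NormLE R (q + 1) (g * h) (c * d) := by
  refine mul_aux (by linarith) hg hh fun a b ha => ?_
  rw [← pow_add]
  refine pow_le_pow_right₀ hR ?_
  rcases Nat.eq_zero_or_pos a with rfl | ha'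
  · simp [h0] at ha
  · omega

/-- The Neumann bound: `‖f - 1‖ ≤ c < 1` gives `‖f⁻¹‖ ≤ 1 / (1 - c)`. -/
lemma inv {f : PowerSeries ℂ} (hf : NormLE R q (f - 1) c) (h0 : PowerSeries.constantCoeff f = 1)
    (hc : c < 1) (hR : 1 ≤ R) : NormLE R q f⁻¹ (1 / (1 - c)) := by
  have hinv : f * f⁻¹ = 1 := PowerSeries.mul_inv_cancel f (by simp [h0])
  have key : f⁻¹ = 1 + -((f - 1) * f⁻¹) := by rw [sub_mul, hinv]; ring
  intro N
  rw [le_div_iff₀ (by linarith)]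
  set S := ∑ r ∈ Finset.range N, R ^ min r q * ‖PowerSeries.coeff r f⁻¹‖ with hS
  have hS0 : 0 ≤ S := Finset.sum_nonneg fun _ _ => by positivity
  have h1 : S ≤ 1 + c * S := by
    have h2 := sum_mul_le (R := R) (p := q) (q := q) (s := q) (by linarith) (f - 1) f⁻¹ N
      (fun a b _ => by
        rw [← pow_add]
        exact pow_le_pow_right₀ hR (by omega))
    have h3 : S ≤ (∑ r ∈ Finset.range N, R ^ min r q * ‖PowerSeries.coeff r (1 : PowerSeries ℂ)‖) +
        ∑ r ∈ Finset.range N, R ^ min r q * ‖PowerSeries.coeff r ((f - 1) * f⁻¹)‖ := by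
      rw [← Finset.sum_add_distrib, hS]
      refine Finset.sum_le_sum fun r _ => ?_
      rw [← mul_add]
      gcongr
      conv_lhs => rw [key]
      rw [map_add, map_neg]
      exact (norm_add_le _ _).trans (by rw [norm_neg])
    have h4 := one (R := R) (q := q) N
    have h5 := mul_le_mul_of_nonneg_right (hf N) hS0
    linarith
  linarith

lemma inv_sub_one {f : PowerSeries ℂ} (hf : NormLE R q (f - 1) c)
    (h0 : PowerSeries.constantCoeff f = 1) (hc : c < 1) (hR : 1 ≤ R) :
    NormLE R q (f⁻¹ - 1) (c / (1 - c)) := by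
  have hinv : f * f⁻¹ = 1 := PowerSeries.mul_inv_cancel f (by simp [h0])
  have key : f⁻¹ - 1 = -((f - 1) * f⁻¹) := by rw [sub_mul, hinv]; ring
  rw [key, div_eq_mul_one_div]
  exact (hf.mul (hf.inv h0 hc hR) hR).neg

lemma mul_sub_one {f g : PowerSeries ℂ} (hf : NormLE R q (f - 1) (Real.exp c - 1))
    (hg : NormLE R q (g - 1) (Real.exp d - 1)) (hR : 1 ≤ R) :
    NormLE R q (f * g - 1) (Real.exp (c + d) - 1) := by
  have key : f * g - 1 = (f - 1) * (g - 1) + (f - 1) + (g - 1) := by ring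
  rw [key]
  refine (((hf.mul hg hR).add hf hR).add hg hR).mono (le_of_eq ?_)
  rw [Real.exp_add]
  ring

/-- A power series in `u`, given by its truncations: a bound for each power of `u` bounds the
composite. -/
lemma of_coeff_eq_sum {u S : PowerSeries ℂ} {a : ℕ → ℂ} {b : ℕ → ℝ} {B : ℝ} (hR : 0 ≤ R)
    (hS : ∀ r, PowerSeries.coeff r S =
      ∑ j ∈ Finset.range (r + 1), a j * PowerSeries.coeff r (u ^ j))
    (hb : ∀ j, NormLE R q (u ^ j) (b j))
    (hB : ∀ N, ∑ j ∈ Finset.range N, ‖a j‖ * b j ≤ B) : NormLE R q S B := by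
  intro N
  refine le_trans ?_ (hB N)
  have h1 : ∀ r ∈ Finset.range N, R ^ min r q * ‖PowerSeries.coeff r S‖ ≤
      ∑ j ∈ Finset.range N, ‖a j‖ * (R ^ min r q * ‖PowerSeries.coeff r (u ^ j)‖) := by
    intro r hr
    rw [Finset.mem_range] at hr
    rw [hS]
    refine (mul_le_mul_of_nonneg_left (norm_sum_le _ _) (by positivity)).trans ?_
    rw [Finset.mul_sum]
    refine le_trans (le_of_eq ?_) (Finset.sum_le_sum_of_subset_of_nonneg
      (Finset.range_mono (Nat.succ_le_of_lt hr)) fun _ _ _ => by positivity)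
    refine Finset.sum_congr rfl fun j _ => ?_
    rw [norm_mul]
    ring
  refine (Finset.sum_le_sum h1).trans ?_
  rw [Finset.sum_comm]
  refine Finset.sum_le_sum fun j _ => ?_
  rw [← Finset.mul_sum]
  exact mul_le_mul_of_nonneg_left (hb j N) (norm_nonneg _)

lemma pow_succ_of_constantCoeff {u : PowerSeries ℂ} (hu : NormLE R (q + 1) u c)
    (hu' : NormLE R q u d) (h0 : PowerSeries.constantCoeff u = 0) (hR : 1 ≤ R) (j : ℕ) :
    NormLE R (q + 1) (u ^ (j + 1)) (c * d ^ j) := by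
  have hp : NormLE R q (u ^ j) (d ^ j) := by
    induction j with
    | zero => simpa using one
    | succ j ih => rw [pow_succ, pow_succ]; exact ih.mul hu' hR
  rw [pow_succ']
  exact hu.mul_succ h0 hp hR

end NormLE

/-! ### The formal logarithm -/

namespace PowerSeries

lemma hasSubst_sub_one {f : PowerSeries ℂ} (hf : constantCoeff f = 1) : HasSubst (f - 1) :=
  HasSubst.of_constantCoeff_zero' (by simp [hf])

lemma derivative_logOf {f : PowerSeries ℂ} (hf : constantCoeff f = 1) :
    derivative ℂ (logOf f) * f = derivative ℂ f := by
  have hs := hasSubst_sub_one hf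
  have h1 : derivative ℂ (log ℂ) * (1 + X) = 1 := by
    rw [deriv_log]
    ext n
    cases n with
    | zero => simp [mul_add]
    | succ n => simp [mul_add, coeff_succ_mul_X, pow_succ, coeff_one]
  have h2 : (derivative ℂ (log ℂ)).subst (f - 1) * f = 1 := by
    have := congrArg (subst (f - 1)) h1
    rw [subst_mul hs, subst_add hs, subst_X hs] at this
    have h3 : subst (f - 1) (1 : PowerSeries ℂ) = 1 := by
      rw [← coe_substAlgHom hs, map_one]
    rw [h3] at this
    simpa using this
  rw [logOf_eq, derivative_subst hs, mul_right_comm, h2]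
  simp

lemma logOf_eq_of_derivative {f L : PowerSeries ℂ} (hf : constantCoeff f = 1)
    (hL : constantCoeff L = 0) (h : derivative ℂ L * f = derivative ℂ f) : logOf f = L := by
  refine derivative.ext ?_ ((constantCoeff_logOf hf).trans hL.symm)
  have hf0 : f ≠ 0 := by
    rintro rfl
    simp at hf
  exact mul_right_cancel₀ hf0 ((derivative_logOf hf).trans h.symm)

lemma logOf_mul {f g : PowerSeries ℂ} (hf : constantCoeff f = 1) (hg : constantCoeff g = 1) :
    logOf (f * g) = logOf f + logOf g := by
  refine logOf_eq_of_derivative (by simp [hf, hg])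
    (by simp [constantCoeff_logOf hf, constantCoeff_logOf hg]) ?_
  have h1 := derivative_logOf hf
  have h2 := derivative_logOf hg
  rw [map_add, Derivation.leibniz, smul_eq_mul, smul_eq_mul, ← h1, ← h2]
  ring

lemma coeff_logOf {f : PowerSeries ℂ} (hf : constantCoeff f = 1) (r : ℕ) :
    coeff r (logOf f) =
      ∑ j ∈ Finset.range (r + 1), ((-1) ^ (j + 1) / (j : ℂ)) * coeff r ((f - 1) ^ j) := by
  rw [logOf_eq, coeff_subst' (hasSubst_sub_one hf),
    finsum_eq_sum_of_support_subset (s := Finset.range (r + 1))]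
  · refine Finset.sum_congr rfl fun j _ => ?_
    rw [coeff_log]
    split_ifs with h
    · simp [h]
    · simp
  · intro j hj
    by_contra hj'
    simp only [Finset.coe_range, Set.mem_Iio, not_lt] at hj'
    apply hj
    have : coeff r ((f - 1) ^ j) = 0 := coeff_of_lt_order _ <| by
      refine lt_of_lt_of_le ?_ (le_order_pow_of_constantCoeff_eq_zero j (by simp [hf]))
      exact_mod_cast hj'
    simp [this]

end PowerSeries

/-- Bound for the logarithm: only the first factor of each power of `f - 1` has to be measured in
the finer norm. -/
lemma NormLE.logOf {R : ℝ} {q : ℕ} {f : PowerSeries ℂ} {c d : ℝ}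
    (hc : NormLE R (q + 1) (f - 1) c) (hd : NormLE R q (f - 1) d)
    (h0 : PowerSeries.constantCoeff f = 1) (hd1 : d < 1) (hR : 1 ≤ R) :
    NormLE R (q + 1) (PowerSeries.logOf f) (c / (1 - d)) := by
  have hu : PowerSeries.constantCoeff (f - 1) = 0 := by simp [h0]
  have hd0 := hd.nonneg
  have hc0 := hc.nonneg
  refine NormLE.of_coeff_eq_sum (u := f - 1) (b := fun j => if j = 0 then 1 else c * d ^ (j - 1))
    (by linarith) (PowerSeries.coeff_logOf h0) ?_ ?_
  · rintro (_ | j)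
    · simpa using NormLE.one
    · simpa using hc.pow_succ_of_constantCoeff hd hu hR j
  · rintro (_ | N)
    · simpa using div_nonneg hc0 (by linarith)
    · rw [Finset.sum_range_succ']
      simp only [Nat.cast_zero, div_zero, norm_zero, zero_mul, add_zero, Nat.succ_ne_zero,
        if_false, Nat.add_sub_cancel]
      calc _ ≤ ∑ j ∈ Finset.range N, c * d ^ j := by
            refine Finset.sum_le_sum fun j _ => ?_
            refine mul_le_of_le_one_left (by positivity) ?_
            simp only [norm_div, norm_pow, norm_neg, norm_one, one_pow]
            rw [Complex.norm_natCast]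
            exact div_le_one_of_le₀ (by push_cast; linarith [Nat.cast_nonneg (α := ℝ) j])
              (by positivity)
        _ ≤ _ := by
            rw [← Finset.mul_sum, div_eq_mul_one_div]
            gcongr
            rw [le_div_iff₀ (by linarith), geom_sum_mul_neg]
            linarith [pow_nonneg hd0 N]

/-! ### Evaluation of power series at `1` -/

namespace PowerSeries

/-- The sum of the coefficients of a power series, i.e. its value at `1`; it is only used for
absolutely summable coefficients. -/
noncomputable def coeffSum (g : PowerSeries ℂ) : ℂ := ∑' r, coeff r g

end PowerSeries

namespace NormLE

variable {R : ℝ} {q : ℕ} {g h : PowerSeries ℂ} {c d : ℝ}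

lemma sum_norm_coeff_le (hg : NormLE R 0 g c) (N : ℕ) :
    ∑ r ∈ Finset.range N, ‖PowerSeries.coeff r g‖ ≤ c := by
  simpa using hg N

lemma summable (hg : NormLE R 0 g c) : Summable fun r => ‖PowerSeries.coeff r g‖ :=
  summable_of_sum_range_le (fun _ => norm_nonneg _) hg.sum_norm_coeff_le

lemma tsum_norm_coeff_le (hg : NormLE R 0 g c) : ∑' r, ‖PowerSeries.coeff r g‖ ≤ c :=
  hg.summable.tsum_le_of_sum_range_le hg.sum_norm_coeff_le

lemma norm_coeffSum_le (hg : NormLE R 0 g c) : ‖g.coeffSum‖ ≤ c :=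
  (norm_tsum_le_tsum_norm hg.summable).trans hg.tsum_norm_coeff_le

/-- The terms of degree at least `q` sum up to at most `c / R ^ q`. -/
lemma norm_coeffSum_sub_le (hg : NormLE R q g c) (hR : 1 ≤ R) :
    ‖g.coeffSum - ∑ r ∈ Finset.range q, PowerSeries.coeff r g‖ ≤ c / R ^ q := by
  have hs := (hg.of_le hR (Nat.zero_le q)).summable
  have hs' : Summable fun r => ‖PowerSeries.coeff (r + q) g‖ :=
    hs.comp_injective (add_left_injective q)
  rw [PowerSeries.coeffSum, ← hs.of_norm.sum_add_tsum_nat_add q, add_sub_cancel_left]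
  refine (norm_tsum_le_tsum_norm hs').trans (hs'.tsum_le_of_sum_range_le fun N => ?_)
  rw [le_div_iff₀ (by positivity), Finset.sum_mul]
  refine le_trans ?_ (hg (q + N))
  rw [Finset.sum_range_add]
  refine le_add_of_nonneg_of_le (Finset.sum_nonneg fun _ _ => by positivity) ?_
  refine Finset.sum_le_sum fun r _ => le_of_eq ?_
  rw [min_eq_right (Nat.le_add_right q r), mul_comm, add_comm]

end NormLE

namespace PowerSeries

lemma coeffSum_one : coeffSum 1 = 1 := by
  rw [coeffSum, tsum_eq_single 0 fun r hr => by simp [coeff_one, hr]]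
  simp

lemma coeffSum_mul {g h : PowerSeries ℂ} (hg : Summable fun r => ‖coeff r g‖)
    (hh : Summable fun r => ‖coeff r h‖) : coeffSum (g * h) = coeffSum g * coeffSum h := by
  simp only [coeffSum, coeff_mul]
  exact (tsum_mul_tsum_eq_tsum_sum_antidiagonal_of_summable_norm (f := fun r => coeff r g)
    (g := fun r => coeff r h) hg hh).symm

lemma coeffSum_add {g h : PowerSeries ℂ} (hg : Summable fun r => ‖coeff r g‖)
    (hh : Summable fun r => ‖coeff r h‖) : coeffSum (g + h) = coeffSum g + coeffSum h := by
  simp only [coeffSum, map_add]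
  exact hg.of_norm.tsum_add hh.of_norm

lemma coeffSum_pow {R : ℝ} (hR : 1 ≤ R) {u : PowerSeries ℂ} {d : ℝ} (hu : NormLE R 0 u d) (j : ℕ) :
    NormLE R 0 (u ^ j) (d ^ j) ∧ coeffSum (u ^ j) = coeffSum u ^ j := by
  induction j with
  | zero => simpa using ⟨NormLE.one, coeffSum_one⟩
  | succ j ih =>
    rw [pow_succ, pow_succ, pow_succ]
    exact ⟨ih.1.mul hu hR, by rw [coeffSum_mul ih.1.summable hu.summable, ih.2]⟩

/-- The formal logarithm sums up to a logarithm of the value: the double series of the coefficients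
of the powers of `f - 1` converges absolutely. -/
lemma exp_coeffSum_logOf {R : ℝ} (hR : 1 ≤ R) {f : PowerSeries ℂ} {d : ℝ}
    (hd : NormLE R 0 (f - 1) d) (h0 : constantCoeff f = 1) (hd1 : d < 1) :
    Complex.exp (coeffSum (logOf f)) = coeffSum f := by
  set u := f - 1 with hu
  have hd0 := hd.nonneg
  have hlt : ‖coeffSum u‖ < 1 := hd.norm_coeffSum_le.trans_lt hd1
  have hf : coeffSum f = 1 + coeffSum u := by
    have : f = 1 + u := by rw [hu]; ring
    rw [this, coeffSum_add (NormLE.one (R := R) (q := 0)).summable hd.summable, coeffSum_one]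
  set a : ℕ → ℂ := fun j => (-1) ^ (j + 1) / (j : ℂ) with ha
  have ha1 : ∀ j, ‖a j‖ ≤ 1 := by
    intro j
    simp only [ha, norm_div, norm_pow, norm_neg, norm_one, one_pow, Complex.norm_natCast]
    rcases j.eq_zero_or_pos with rfl | hj
    · simp
    · exact div_le_one_of_le₀ (by exact_mod_cast hj) (by positivity)
  have hrow : ∀ r, coeff r (logOf f) = ∑' j, a j * coeff r (u ^ j) := by
    intro r
    rw [coeff_logOf h0, tsum_eq_sum]
    intro j hj
    have : coeff r (u ^ j) = 0 := coeff_of_lt_order _ <| by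
      refine lt_of_lt_of_le ?_ (le_order_pow_of_constantCoeff_eq_zero j (by simp [hu, h0]))
      simp only [Finset.mem_range, not_lt] at hj
      exact_mod_cast hj
    rw [this, mul_zero]
  have hsum : Summable (Function.uncurry fun j r => a j * coeff r (u ^ j)) := by
    refine Summable.of_norm ((summable_prod_of_nonneg fun _ => norm_nonneg _).2 ⟨fun j => ?_, ?_⟩)
    · simp only [Function.uncurry, norm_mul]
      exact (coeffSum_pow hR hd j).1.summable.mul_left _
    · refine Summable.of_nonneg_of_le (fun j => tsum_nonneg fun _ => norm_nonneg _) (fun j => ?_)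
        (summable_geometric_of_lt_one hd0 hd1)
      simp only [Function.uncurry, norm_mul]
      rw [tsum_mul_left]
      exact (mul_le_of_le_one_left (tsum_nonneg fun _ => norm_nonneg _) (ha1 j)).trans
        (coeffSum_pow hR hd j).1.tsum_norm_coeff_le
  have key : coeffSum (logOf f) = Complex.log (1 + coeffSum u) := by
    rw [← (Complex.hasSum_taylorSeries_log hlt).tsum_eq, coeffSum]
    simp_rw [hrow]
    rw [hsum.tsum_comm]
    refine tsum_congr fun j => ?_
    rw [tsum_mul_left]
    change a j * coeffSum (u ^ j) = _
    rw [(coeffSum_pow hR hd j).2, ha]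
    ring
  rw [key, hf, Complex.exp_log]
  intro h
  have : coeffSum u = -1 := by linear_combination h
  rw [this] at hlt
  simp at hlt

/-! ### Formal exponentials of scalars -/

/-- The formal power series of `z ↦ exp (c * z)`. -/
noncomputable def expSeries (c : ℂ) : PowerSeries ℂ := rescale c (exp ℂ)

lemma coeff_expSeries (c : ℂ) (r : ℕ) : coeff r (expSeries c) = c ^ r / (Nat.factorial r : ℂ) := by
  rw [expSeries, coeff_rescale, coeff_exp]
  simp [div_eq_mul_inv]

lemma constantCoeff_expSeries (c : ℂ) : constantCoeff (expSeries c) = 1 := by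
  rw [← coeff_zero_eq_constantCoeff_apply, coeff_expSeries]
  simp

lemma expSeries_add (a b : ℂ) : expSeries (a + b) = expSeries a * expSeries b :=
  (exp_mul_exp_eq_exp_add a b).symm

lemma logOf_expSeries (c : ℂ) : logOf (expSeries c) = C c * X := by
  refine logOf_eq_of_derivative (constantCoeff_expSeries c) (by simp) ?_
  ext r
  rw [coeff_derivative, coeff_expSeries]
  simp only [Derivation.leibniz, derivative_X, derivative_C, smul_eq_mul, mul_one, mul_zero,
    add_zero, coeff_C_mul, coeff_expSeries, Nat.factorial_succ]
  have h1 : ((r : ℂ) + 1) ≠ 0 := by exact_mod_cast Nat.succ_ne_zero r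
  have h2 : ((Nat.factorial r : ℕ) : ℂ) ≠ 0 := by exact_mod_cast Nat.factorial_ne_zero r
  push_cast
  field_simp
  ring

lemma hasSum_coeff_expSeries (c : ℂ) : HasSum (fun r => coeff r (expSeries c)) (Complex.exp c) := by
  simp only [coeff_expSeries]
  rw [Complex.exp_eq_exp_ℂ]
  exact NormedSpace.expSeries_div_hasSum_exp c

lemma normLE_expSeries_sub_one {R : ℝ} (hR : 1 ≤ R) (q : ℕ) {c : ℂ} {φ : ℝ} (hc : ‖c‖ ≤ φ)
    (hφ : R * φ < 2) : NormLE R q (expSeries c - 1) (R * φ / (1 - R * φ / 2)) := by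
  have hφ0 : 0 ≤ φ := (norm_nonneg c).trans hc
  rintro (_ | N)
  · simpa using div_nonneg (by positivity) (by linarith)
  rw [Finset.sum_range_succ']
  have h0 : coeff 0 (expSeries c - 1) = 0 := by simp [constantCoeff_expSeries]
  rw [h0, norm_zero, mul_zero, add_zero]
  calc _ ≤ ∑ r ∈ Finset.range N, (R * φ) * (R * φ / 2) ^ r := by
        refine Finset.sum_le_sum fun r _ => ?_
        have h1 : coeff (r + 1) (expSeries c - 1) = c ^ (r + 1) / (Nat.factorial (r + 1) : ℂ) := by
          rw [map_sub, coeff_expSeries, coeff_one]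
          simp
        rw [h1, norm_div, norm_pow, Complex.norm_natCast]
        have h2 : (2 : ℝ) ^ r ≤ (Nat.factorial (r + 1) : ℝ) := by
          have := Nat.factorial_mul_pow_le_factorial (m := 1) (n := r)
          rw [Nat.factorial_one, one_mul, add_comm 1 r] at this
          exact_mod_cast this
        have h3 : R ^ min (r + 1) q ≤ R ^ (r + 1) := pow_le_pow_right₀ hR (by omega)
        calc _ ≤ R ^ (r + 1) * (φ ^ (r + 1) / 2 ^ r) := by
              gcongr
          _ = _ := by
              rw [pow_succ, pow_succ, div_pow, mul_pow]
              ring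
    _ ≤ _ := by
        rw [← Finset.mul_sum, div_eq_mul_one_div _ (1 - _)]
        refine mul_le_mul_of_nonneg_left ?_ (by positivity)
        rw [le_div_iff₀ (by linarith), geom_sum_mul_neg]
        linarith [pow_nonneg (show 0 ≤ R * φ / 2 by positivity) N]

end PowerSeries

/-! ### Products of many factors close to one -/

/-- The form of `NormLE.inv_sub_one` in which bounds for several factors multiply. The exponent grows
by the factor `5 / 4`, which the rates of the exponential moments leave room for. -/
lemma NormLE.inv_sub_one_exp {R : ℝ} {q : ℕ} {f : PowerSeries ℂ} {c : ℝ}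
    (hf : NormLE R q (f - 1) (Real.exp c - 1)) (h0 : PowerSeries.constantCoeff f = 1)
    (hc0 : 0 ≤ c) (hc : c ≤ 1 / 10) (hR : 1 ≤ R) :
    NormLE R q (f⁻¹ - 1) (Real.exp (5 / 4 * c) - 1) := by
  have h1 : Real.exp c ≤ 1 + c + c ^ 2 := by
    have := Real.abs_exp_sub_one_sub_id_le (x := c) (by rw [abs_of_nonneg hc0]; linarith)
    linarith [(abs_le.1 this).2]
  have h2 : 1 + 5 / 4 * c ≤ Real.exp (5 / 4 * c) := by linarith [Real.add_one_le_exp (5 / 4 * c)]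
  have h3 : c ^ 2 ≤ c / 10 := by nlinarith
  have h4 : 0 < 2 - Real.exp c := by linarith
  refine (hf.inv_sub_one h0 (by linarith) hR).mono ?_
  rw [div_le_iff₀ (by linarith)]
  have h5 : (1 - c - c ^ 2) * (1 + 5 / 4 * c) ≤ (2 - Real.exp c) * Real.exp (5 / 4 * c) := by
    refine mul_le_mul (by linarith) h2 (by linarith) h4.le
  nlinarith [mul_nonneg hc0 (sub_nonneg.2 hc), mul_nonneg (mul_nonneg hc0 hc0) (sub_nonneg.2 hc)]

/-- If adding a single element to a subset of `𝒱` multiplies `D` by a factor close to one, then so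
does adding a set of elements, with additive exponents. -/
lemma NormLE.union_ratio {ι : Type*} [DecidableEq ι] {R : ℝ} (hR : 1 ≤ R) {q : ℕ}
    {D : Finset ι → PowerSeries ℂ} (hD : ∀ ℬ, PowerSeries.constantCoeff (D ℬ) = 1)
    {c : ι → ℝ} {𝒱 : Finset ι}
    (hstep : ∀ ℬ ⊆ 𝒱, ∀ W ∈ 𝒱, W ∉ ℬ →
      NormLE R q (D (insert W ℬ) * (D ℬ)⁻¹ - 1) (Real.exp (c W) - 1))
    {ℬ : Finset ι} (hℬ : ℬ ⊆ 𝒱) {𝒞 : Finset ι} (h𝒞 : 𝒞 ⊆ 𝒱) (hd : Disjoint ℬ 𝒞) :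
    NormLE R q (D (ℬ ∪ 𝒞) * (D ℬ)⁻¹ - 1) (Real.exp (∑ W ∈ 𝒞, c W) - 1) := by
  have hinv : ∀ 𝒜, (D 𝒜)⁻¹ * D 𝒜 = 1 := fun 𝒜 => PowerSeries.inv_mul_cancel _ (by simp [hD])
  induction 𝒞 using Finset.induction_on with
  | empty =>
    simp only [Finset.union_empty, Finset.sum_empty, Real.exp_zero, sub_self]
    rw [mul_comm, hinv, sub_self]
    exact NormLE.zero
  | insert W 𝒞 hW ih =>
    rw [Finset.insert_subset_iff] at h𝒞
    rw [Finset.disjoint_insert_right] at hd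
    have h1 := ih h𝒞.2 hd.2
    have h2 := hstep (ℬ ∪ 𝒞) (Finset.union_subset hℬ h𝒞.2) W h𝒞.1
      (by simp [hW, hd.1])
    rw [Finset.sum_insert hW, Finset.union_insert]
    convert h2.mul_sub_one h1 hR using 2
    calc _ = D (insert W (ℬ ∪ 𝒞)) * ((D (ℬ ∪ 𝒞))⁻¹ * D (ℬ ∪ 𝒞)) * (D ℬ)⁻¹ := by
          rw [hinv, mul_one]
      _ = _ := by ring

/-- The binomial sum `(1 + y) ^ k`, truncated after the power `y ^ q`. -/
noncomputable def truncBinom (k q : ℕ) (y : ℝ) : ℝ :=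
  ∑ t ∈ Finset.range (q + 1), (k.choose t : ℝ) * y ^ t

lemma truncBinom_nonneg {y : ℝ} (hy : 0 ≤ y) (k q : ℕ) : 0 ≤ truncBinom k q y :=
  Finset.sum_nonneg fun _ _ => by positivity

@[simp] lemma truncBinom_zero_right (k : ℕ) (y : ℝ) : truncBinom k 0 y = 1 := by
  simp [truncBinom]

lemma truncBinom_succ_succ (k q : ℕ) (y : ℝ) :
    truncBinom (k + 1) (q + 1) y = truncBinom k (q + 1) y + y * truncBinom k q y := by
  simp only [truncBinom]
  rw [Finset.sum_range_succ' (fun t => ((k + 1).choose t : ℝ) * y ^ t),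
    Finset.sum_range_succ' (fun t => (k.choose t : ℝ) * y ^ t), Finset.mul_sum, add_right_comm,
    ← Finset.sum_add_distrib]
  simp only [Nat.choose_zero_right]
  congr 1
  refine Finset.sum_congr rfl fun t _ => ?_
  rw [Nat.choose_succ_succ]
  push_cast
  ring

lemma truncBinom_succ_le {y : ℝ} (hy : 0 ≤ y) (k q : ℕ) :
    truncBinom (k + 1) q y ≤ (1 + y) * truncBinom k q y := by
  cases q with
  | zero => simpa using hy
  | succ q =>
    rw [truncBinom_succ_succ, add_mul, one_mul]
    gcongr
    rw [truncBinom, truncBinom, Finset.sum_range_succ _ (q + 1)]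
    exact le_add_of_nonneg_right (by positivity)

/-- A family `𝒱` is built up from its members disjoint from `K` by releasing the points of `K` one
at a time. If each release multiplies `D` by a factor `1 + p` with `p` without constant term, then
expanding the product and using that each `p` costs one degree of truncation yields a truncated
binomial sum, rather than an exponential in `|K|` with a large rate. -/
lemma NormLE.ratio_filter_disjoint {n : ℕ} {R : ℝ} (hR : 1 ≤ R) {m : ℕ}
    {D : Finset (Finset (Fin n)) → PowerSeries ℂ}
    (hD : ∀ ℬ, PowerSeries.constantCoeff (D ℬ) = 1) {𝒱 : Finset (Finset (Fin n))} {y lam : ℝ}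
    (hy : 0 ≤ y) (hlam : 0 ≤ lam)
    (hm : ∀ (K : Finset (Fin n)) (j : Fin n), NormLE R m
      (D {W ∈ 𝒱 | Disjoint W K} * (D {W ∈ 𝒱 | Disjoint W (insert j K)})⁻¹ - 1) y)
    (h0 : ∀ (K : Finset (Fin n)) (j : Fin n), NormLE R 0
      (D {W ∈ 𝒱 | Disjoint W K} * (D {W ∈ 𝒱 | Disjoint W (insert j K)})⁻¹ - 1)
        (Real.exp lam - 1))
    (K : Finset (Fin n)) (q : ℕ) (hq : q ≤ m) :
    NormLE R q (D 𝒱 * (D {W ∈ 𝒱 | Disjoint W K})⁻¹)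
      (Real.exp (lam * K.card) * truncBinom K.card q y) := by
  have hinv : ∀ 𝒜, (D 𝒜)⁻¹ * D 𝒜 = 1 := fun 𝒜 => PowerSeries.inv_mul_cancel _ (by simp [hD])
  induction K using Finset.induction_on generalizing q with
  | empty =>
    have : ({W ∈ 𝒱 | Disjoint W ∅} : Finset (Finset (Fin n))) = 𝒱 := by simp
    rw [this, mul_comm, hinv]
    refine NormLE.one.mono ?_
    rw [truncBinom, Finset.sum_range_succ']
    simp
  | insert j K hj ih =>
    set p := D {W ∈ 𝒱 | Disjoint W K} * (D {W ∈ 𝒱 | Disjoint W (insert j K)})⁻¹ - 1 with hp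
    have hp0 : PowerSeries.constantCoeff p = 0 := by simp [hp, hD]
    have key : D 𝒱 * (D {W ∈ 𝒱 | Disjoint W (insert j K)})⁻¹ =
        D 𝒱 * (D {W ∈ 𝒱 | Disjoint W K})⁻¹ + p * (D 𝒱 * (D {W ∈ 𝒱 | Disjoint W K})⁻¹) := by
      calc _ = D 𝒱 * ((D {W ∈ 𝒱 | Disjoint W K})⁻¹ * D {W ∈ 𝒱 | Disjoint W K}) *
            (D {W ∈ 𝒱 | Disjoint W (insert j K)})⁻¹ := by rw [hinv, mul_one]
        _ = _ := by rw [hp]; ring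
    have hexp : Real.exp (lam * ((K.card + 1 : ℕ) : ℝ)) =
        Real.exp lam * Real.exp (lam * K.card) := by
      rw [← Real.exp_add]
      push_cast
      ring_nf
    have h1 : 1 ≤ Real.exp lam := Real.one_le_exp hlam
    rw [key, Finset.card_insert_of_notMem hj, hexp]
    cases q with
    | zero =>
      have h2 := ih 0 hq
      refine (h2.add ((h0 K j).mul h2 hR) hR).mono (le_of_eq ?_)
      simp only [truncBinom_zero_right]
      ring
    | succ q =>
      have h2 := ih (q + 1) hq
      have h3 := ih q (by omega)
      refine (h2.add (((hm K j).of_le hR hq).mul_succ hp0 h3 hR) hR).mono ?_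
      rw [truncBinom_succ_succ]
      have h4 := truncBinom_nonneg hy K.card (q + 1)
      have h5 := truncBinom_nonneg hy K.card q
      calc _ = 1 * Real.exp (lam * K.card) *
            (truncBinom K.card (q + 1) y + y * truncBinom K.card q y) := by ring
        _ ≤ _ := by gcongr

/-! ### Integrals of formal power series -/

section IntegralSeries

variable {Y : Type*} [MeasurableSpace Y] {μ : Measure Y}

/-- The coefficientwise integral of a function with values in formal power series. -/
noncomputable def integralSeries (μ : Measure Y) (G : Y → PowerSeries ℂ) : PowerSeries ℂ :=
  PowerSeries.mk fun r => ∫ y, PowerSeries.coeff r (G y) ∂μ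

lemma coeff_integralSeries (G : Y → PowerSeries ℂ) (r : ℕ) :
    PowerSeries.coeff r (integralSeries μ G) = ∫ y, PowerSeries.coeff r (G y) ∂μ := by
  simp [integralSeries]

lemma measurable_coeff_mul {F G : Y → PowerSeries ℂ}
    (hF : ∀ r, Measurable fun y => PowerSeries.coeff r (F y))
    (hG : ∀ r, Measurable fun y => PowerSeries.coeff r (G y)) (r : ℕ) :
    Measurable fun y => PowerSeries.coeff r (F y * G y) := by
  simp only [PowerSeries.coeff_mul]
  exact Finset.measurable_fun_sum _ fun p _ => (hF p.1).mul (hG p.2)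

lemma mul_integralSeries {G : Y → PowerSeries ℂ} (K : PowerSeries ℂ)
    (hG : ∀ r, Integrable (fun y => PowerSeries.coeff r (G y)) μ) :
    K * integralSeries μ G = integralSeries μ fun y => K * G y := by
  ext r
  rw [coeff_integralSeries, PowerSeries.coeff_mul]
  simp only [PowerSeries.coeff_mul, coeff_integralSeries]
  rw [integral_finsetSum _ fun x _ => (hG x.2).const_mul _]
  exact Finset.sum_congr rfl fun x _ => (integral_const_mul _ _).symm

lemma NormLE.integralSeries [IsProbabilityMeasure μ] {R : ℝ} (hR : 1 ≤ R) {q : ℕ}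
    {G : Y → PowerSeries ℂ} {c : ℝ} (hm : ∀ r, Measurable fun y => PowerSeries.coeff r (G y))
    (hG : ∀ y, NormLE R q (G y) c) : NormLE R q (integralSeries μ G) c := by
  have hint : ∀ r, Integrable (fun y => PowerSeries.coeff r (G y)) μ := fun r => by
    refine Integrable.of_bound (hm r).aestronglyMeasurable c (Filter.Eventually.of_forall fun y => ?_)
    refine le_trans ?_ ((hG y).coeff_le (by linarith) r)
    exact le_mul_of_one_le_left (norm_nonneg _) (one_le_pow₀ hR)
  intro N
  calc _ ≤ ∑ r ∈ Finset.range N, R ^ min r q * ∫ y, ‖PowerSeries.coeff r (G y)‖ ∂μ := by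
        refine Finset.sum_le_sum fun r _ => ?_
        rw [coeff_integralSeries]
        gcongr
        exact norm_integral_le_integral_norm _
    _ = ∫ y, ∑ r ∈ Finset.range N, R ^ min r q * ‖PowerSeries.coeff r (G y)‖ ∂μ := by
        rw [integral_finsetSum _ fun r _ => ((hint r).norm.const_mul _)]
        exact Finset.sum_congr rfl fun r _ => (integral_const_mul _ _).symm
    _ ≤ ∫ _, c ∂μ := by
        refine integral_mono (integrable_finsetSum _ fun r _ => ((hint r).norm.const_mul _))
          (integrable_const _) fun y => hG y N
    _ = c := by simp

end IntegralSeries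

/-! ### Resampling coordinates of a product measure -/

section Resampling

variable {n : ℕ} {Ω : Fin n → Type*}

lemma replaceOn_univ (x y : ∀ i, Ω i) : replaceOn Finset.univ x y = y := by
  ext i
  simp [replaceOn]

lemma replaceOn_replaceOn_sdiff (A V : Finset (Fin n)) (x y z : ∀ i, Ω i) :
    replaceOn A x (replaceOn (A \ V) y z) = replaceOn (A \ V) (replaceOn A x y) z := by
  ext i
  by_cases h1 : i ∈ A <;> by_cases h2 : i ∈ V <;> simp [replaceOn, h1, h2]

variable [∀ i, MeasurableSpace (Ω i)]

lemma measurable_replaceOn (V : Finset (Fin n)) :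
    Measurable fun p : (∀ i, Ω i) × (∀ i, Ω i) => replaceOn V p.1 p.2 := by
  refine measurable_pi_lambda _ fun i => ?_
  by_cases h : i ∈ V
  · simpa [replaceOn, h, Function.comp_def] using
      (measurable_pi_apply (X := Ω) i).comp measurable_snd
  · simpa [replaceOn, h, Function.comp_def] using
      (measurable_pi_apply (X := Ω) i).comp measurable_fst

lemma measurable_replaceOn_right (V : Finset (Fin n)) (x : ∀ i, Ω i) :
    Measurable fun y : ∀ i, Ω i => replaceOn V x y :=
  (measurable_replaceOn V).comp measurable_prodMk_left

lemma measurable_replaceOn_left (V : Finset (Fin n)) (y : ∀ i, Ω i) :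
    Measurable fun x : ∀ i, Ω i => replaceOn V x y :=
  (measurable_replaceOn V).comp measurable_prodMk_right

variable (ν : ∀ i, Measure (Ω i)) [∀ i, IsProbabilityMeasure (ν i)]

lemma map_replaceOn_prod (V : Finset (Fin n)) :
    ((Measure.pi ν).prod (Measure.pi ν)).map (fun p => replaceOn V p.1 p.2) = Measure.pi ν := by
  refine (Measure.pi_eq fun s hs => ?_).symm
  rw [Measure.map_apply (measurable_replaceOn V) (MeasurableSet.univ_pi hs)]
  have h : (fun p : (∀ i, Ω i) × (∀ i, Ω i) => replaceOn V p.1 p.2) ⁻¹' Set.univ.pi s =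
      (Set.univ.pi fun i => if i ∈ V then Set.univ else s i) ×ˢ
        (Set.univ.pi fun i => if i ∈ V then s i else Set.univ) := by
    ext p
    simp only [Set.mem_preimage, Set.mem_univ_pi, Set.mem_prod, ← forall_and]
    refine forall_congr' fun i => ?_
    by_cases h : i ∈ V <;> simp [replaceOn, h]
  rw [h, Measure.prod_prod, Measure.pi_pi, Measure.pi_pi, ← Finset.prod_mul_distrib]
  refine Finset.prod_congr rfl fun i _ => ?_
  by_cases h : i ∈ V <;> simp [h]

lemma integral_eq_integral_integral_replaceOn (V : Finset (Fin n)) {H : (∀ i, Ω i) → ℂ}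
    (hH : Measurable H) {C : ℝ} (hC : ∀ x, ‖H x‖ ≤ C) :
    ∫ y, H y ∂Measure.pi ν =
      ∫ y, ∫ z, H (replaceOn V y z) ∂Measure.pi ν ∂Measure.pi ν := by
  conv_lhs => rw [← map_replaceOn_prod ν V]
  rw [integral_map (measurable_replaceOn V).aemeasurable hH.aestronglyMeasurable]
  exact integral_prod _ (Integrable.of_bound
    (hH.comp (measurable_replaceOn V)).aestronglyMeasurable C
    (Filter.Eventually.of_forall fun _ => hC _))

end Resampling

/-! ### Partition series of an interaction -/

section Interaction

variable {n : ℕ} {Ω : Fin n → Type*} [∀ i, MeasurableSpace (Ω i)]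

/-- A bounded measurable many-body interaction: `g V` depends only on the coordinates in `V` and is
bounded by `φ V`. -/
structure IsInteraction (g : Finset (Fin n) → (∀ i, Ω i) → ℂ) (φ : Finset (Fin n) → ℝ) : Prop where
  measurable : ∀ V, Measurable (g V)
  congr : ∀ V x y, (∀ i ∈ V, x i = y i) → g V x = g V y
  norm_le : ∀ V x, ‖g V x‖ ≤ φ V

variable (ν : ∀ i, Measure (Ω i)) (g : Finset (Fin n) → (∀ i, Ω i) → ℂ)

/-- The formal power series in `z` of `E exp (z * ∑ V ∈ ℬ, g V)`, where the coordinates in `A` are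
averaged over the product measure and those outside `A` are frozen at their values in `x`. -/
noncomputable def partitionSeries (ℬ : Finset (Finset (Fin n))) (A : Finset (Fin n))
    (x : ∀ i, Ω i) : PowerSeries ℂ :=
  integralSeries (Measure.pi ν) fun y =>
    PowerSeries.expSeries (∑ V ∈ ℬ, g V (replaceOn A x y))

/-- Coordinates that no term of the family depends on are irrelevant. -/
lemma IsInteraction.partitionSeries_congr {ν : ∀ i, Measure (Ω i)}
    {g : Finset (Fin n) → (∀ i, Ω i) → ℂ} {φ : Finset (Fin n) → ℝ} (hg : IsInteraction g φ)
    {ℬ : Finset (Finset (Fin n))} {A A' : Finset (Fin n)}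
    {x x' : ∀ i, Ω i} (h : ∀ V ∈ ℬ, ∀ i ∈ V, (i ∈ A ↔ i ∈ A') ∧ (i ∉ A → x i = x' i)) :
    partitionSeries ν g ℬ A x = partitionSeries ν g ℬ A' x' := by
  refine congrArg (integralSeries (Measure.pi ν)) (funext fun y =>
    congrArg PowerSeries.expSeries ?_)
  refine Finset.sum_congr rfl fun V hV => hg.congr V _ _ fun i hi => ?_
  obtain ⟨h1, h2⟩ := h V hV i hi
  by_cases hA : i ∈ A
  · simp [replaceOn, hA, h1.1 hA]
  · have hA' : i ∉ A' := fun h' => hA (h1.2 h')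
    simp [replaceOn, hA, hA', h2 hA]

variable {g} {φ : Finset (Fin n) → ℝ} [∀ i, IsProbabilityMeasure (ν i)]

lemma constantCoeff_partitionSeries (ℬ : Finset (Finset (Fin n))) (A : Finset (Fin n))
    (x : ∀ i, Ω i) : PowerSeries.constantCoeff (partitionSeries ν g ℬ A x) = 1 := by
  rw [← PowerSeries.coeff_zero_eq_constantCoeff_apply, partitionSeries, coeff_integralSeries]
  simp [PowerSeries.constantCoeff_expSeries]

lemma partitionSeries_empty (A : Finset (Fin n)) (x : ∀ i, Ω i) :
    partitionSeries ν g ∅ A x = 1 := by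
  ext r
  rw [partitionSeries, coeff_integralSeries]
  simp only [Finset.sum_empty, PowerSeries.coeff_expSeries, integral_const, PowerSeries.coeff_one]
  cases r <;> simp

namespace IsInteraction

variable {ν} (hg : IsInteraction g φ)
include hg

lemma measurable_sum (ℬ : Finset (Finset (Fin n))) : Measurable fun x => ∑ V ∈ ℬ, g V x :=
  Finset.measurable_fun_sum _ fun V _ => hg.measurable V

lemma norm_sum_le (ℬ : Finset (Finset (Fin n))) (x : ∀ i, Ω i) :
    ‖∑ V ∈ ℬ, g V x‖ ≤ ∑ V ∈ ℬ, φ V :=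
  norm_sum_le_of_le _ fun V _ => hg.norm_le V x

lemma measurable_coeff_expSeries_sum (ℬ : Finset (Finset (Fin n))) (r : ℕ) :
    Measurable fun x => PowerSeries.coeff r (PowerSeries.expSeries (∑ V ∈ ℬ, g V x)) := by
  simp only [PowerSeries.coeff_expSeries]
  exact ((hg.measurable_sum ℬ).pow_const r).div_const _

lemma norm_coeff_expSeries_sum_le (ℬ : Finset (Finset (Fin n))) (r : ℕ) (x : ∀ i, Ω i) :
    ‖PowerSeries.coeff r (PowerSeries.expSeries (∑ V ∈ ℬ, g V x))‖ ≤
      (∑ V ∈ ℬ, φ V) ^ r / (Nat.factorial r : ℝ) := by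
  rw [PowerSeries.coeff_expSeries, norm_div, norm_pow, Complex.norm_natCast]
  gcongr
  exact hg.norm_sum_le ℬ x

lemma integrable_coeff (ℬ : Finset (Finset (Fin n))) (A : Finset (Fin n)) (x : ∀ i, Ω i) (r : ℕ) :
    Integrable (fun y => PowerSeries.coeff r
      (PowerSeries.expSeries (∑ V ∈ ℬ, g V (replaceOn A x y)))) (Measure.pi ν) :=
  Integrable.of_bound ((hg.measurable_coeff_expSeries_sum ℬ r).comp
    (measurable_replaceOn_right A x)).aestronglyMeasurable _
    (Filter.Eventually.of_forall fun _ => hg.norm_coeff_expSeries_sum_le ℬ r _)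

lemma measurable_coeff_partitionSeries (ℬ : Finset (Finset (Fin n))) (A : Finset (Fin n)) (r : ℕ) :
    Measurable fun x => PowerSeries.coeff r (partitionSeries ν g ℬ A x) := by
  have h : Measurable fun p : (∀ i, Ω i) × (∀ i, Ω i) => PowerSeries.coeff r
      (PowerSeries.expSeries (∑ V ∈ ℬ, g V (replaceOn A p.1 p.2))) :=
    Measurable.comp (g := fun w => PowerSeries.coeff r (PowerSeries.expSeries (∑ V ∈ ℬ, g V w)))
      (hg.measurable_coeff_expSeries_sum ℬ r) (measurable_replaceOn A)
  have h' : Measurable fun x => ∫ y, PowerSeries.coeff r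
      (PowerSeries.expSeries (∑ V ∈ ℬ, g V (replaceOn A x y))) ∂Measure.pi ν :=
    (StronglyMeasurable.integral_prod_right (ν := Measure.pi ν) (f := fun x y => PowerSeries.coeff r
      (PowerSeries.expSeries (∑ V ∈ ℬ, g V (replaceOn A x y)))) h.stronglyMeasurable).measurable
  have h2 : (fun x => PowerSeries.coeff r (partitionSeries ν g ℬ A x)) = fun x =>
      ∫ y, PowerSeries.coeff r (PowerSeries.expSeries (∑ V ∈ ℬ, g V (replaceOn A x y)))
        ∂Measure.pi ν := by
    funext x
    rw [partitionSeries, coeff_integralSeries]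
  rw [h2]
  exact h'

/-- The effect of one additional term `g V`: the coordinates in `A ∩ V` are averaged last. -/
lemma partitionSeries_insert {ℬ : Finset (Finset (Fin n))} {V : Finset (Fin n)} (hV : V ∉ ℬ)
    (A : Finset (Fin n)) (x : ∀ i, Ω i) :
    partitionSeries ν g (insert V ℬ) A x = partitionSeries ν g ℬ A x +
      integralSeries (Measure.pi ν) fun y =>
        (PowerSeries.expSeries (g V (replaceOn A x y)) - 1) *
          partitionSeries ν g ℬ (A \ V) (replaceOn A x y) := by
  have hmul : ∀ w, PowerSeries.expSeries (∑ W ∈ insert V ℬ, g W w) =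
      PowerSeries.expSeries (∑ W ∈ ℬ, g W w) + (PowerSeries.expSeries (g V w) - 1) *
        PowerSeries.expSeries (∑ W ∈ ℬ, g W w) := by
    intro w
    rw [Finset.sum_insert hV, PowerSeries.expSeries_add]
    ring
  ext r
  set H : (∀ i, Ω i) → ℂ := fun w => PowerSeries.coeff r ((PowerSeries.expSeries (g V w) - 1) *
        PowerSeries.expSeries (∑ W ∈ ℬ, g W w)) with hH
  have hH' : ∀ w, H w = PowerSeries.coeff r (PowerSeries.expSeries (∑ W ∈ insert V ℬ, g W w)) -
      PowerSeries.coeff r (PowerSeries.expSeries (∑ W ∈ ℬ, g W w)) := by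
    intro w
    rw [hmul, map_add, hH]
    ring
  have hHm : Measurable H := by
    rw [funext hH']
    exact (hg.measurable_coeff_expSeries_sum _ r).sub (hg.measurable_coeff_expSeries_sum _ r)
  have hHb : ∀ w, ‖H w‖ ≤ (∑ V ∈ insert V ℬ, φ V) ^ r / (Nat.factorial r : ℝ) +
      (∑ V ∈ ℬ, φ V) ^ r / (Nat.factorial r : ℝ) := by
    intro w
    rw [hH']
    exact (norm_sub_le _ _).trans (add_le_add (hg.norm_coeff_expSeries_sum_le _ r w)
      (hg.norm_coeff_expSeries_sum_le _ r w))
  have hA := measurable_replaceOn_right A x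
  rw [map_add, partitionSeries, partitionSeries, coeff_integralSeries, coeff_integralSeries,
    coeff_integralSeries]
  have h1 : ∀ y, PowerSeries.coeff r
      (PowerSeries.expSeries (∑ W ∈ insert V ℬ, g W (replaceOn A x y))) =
      PowerSeries.coeff r (PowerSeries.expSeries (∑ W ∈ ℬ, g W (replaceOn A x y))) +
        H (replaceOn A x y) := by
    intro y
    rw [hH']
    ring
  simp_rw [h1]
  have hHA : Measurable fun y => H (replaceOn A x y) := hHm.comp hA
  rw [integral_add (hg.integrable_coeff ℬ A x r) (Integrable.of_bound
    hHA.aestronglyMeasurable _ (Filter.Eventually.of_forall fun _ => hHb _))]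
  congr 1
  rw [integral_eq_integral_integral_replaceOn ν (A \ V) hHA fun _ => hHb _]
  refine integral_congr_ae (Filter.Eventually.of_forall fun y => ?_)
  simp only [partitionSeries]
  rw [mul_integralSeries _ fun s => hg.integrable_coeff ℬ (A \ V) (replaceOn A x y) s,
    coeff_integralSeries]
  refine integral_congr_ae (Filter.Eventually.of_forall fun z => ?_)
  simp only [hH, replaceOn_replaceOn_sdiff]
  rw [hg.congr V (replaceOn (A \ V) (replaceOn A x y) z) (replaceOn A x y) fun i hi => by
    simp [replaceOn, hi]]

lemma measurable_coeff_insert_integrand (ℬ : Finset (Finset (Fin n))) (V A : Finset (Fin n))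
    (x : ∀ i, Ω i) (r : ℕ) : Measurable fun y => PowerSeries.coeff r
      ((PowerSeries.expSeries (g V (replaceOn A x y)) - 1) *
        partitionSeries ν g ℬ (A \ V) (replaceOn A x y)) := by
  refine measurable_coeff_mul (fun s => ?_) (fun s => ?_) r
  · simp only [map_sub, PowerSeries.coeff_expSeries]
    exact ((((hg.measurable V).comp (measurable_replaceOn_right A x)).pow_const s).div_const
      (Nat.factorial s : ℂ)).sub_const _
  · exact (hg.measurable_coeff_partitionSeries ℬ (A \ V) s).comp (measurable_replaceOn_right A x)

lemma norm_coeff_partitionSeries_le (ℬ : Finset (Finset (Fin n))) (A : Finset (Fin n))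
    (x : ∀ i, Ω i) (r : ℕ) : ‖PowerSeries.coeff r (partitionSeries ν g ℬ A x)‖ ≤
      (∑ V ∈ ℬ, φ V) ^ r / (Nat.factorial r : ℝ) := by
  rw [partitionSeries, coeff_integralSeries]
  refine (norm_integral_le_of_norm_le_const (Filter.Eventually.of_forall fun y =>
    hg.norm_coeff_expSeries_sum_le ℬ r _)).trans ?_
  simp

/-- The relative change of the partition series caused by one additional term `g V`, in terms of
ratios of partition series in which the coordinates of `V` are frozen or released. -/
lemma partitionSeries_insert_ratio {ℬ : Finset (Finset (Fin n))} {V : Finset (Fin n)} (hV : V ∉ ℬ)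
    (A : Finset (Fin n)) (x : ∀ i, Ω i) :
    partitionSeries ν g (insert V ℬ) A x * (partitionSeries ν g ℬ A x)⁻¹ - 1 =
      integralSeries (Measure.pi ν) fun y =>
        (PowerSeries.expSeries (g V (replaceOn A x y)) - 1) *
          (partitionSeries ν g ℬ (A \ V) (replaceOn A x y) * (partitionSeries ν g ℬ A x)⁻¹) := by
  have hinv : partitionSeries ν g ℬ A x * (partitionSeries ν g ℬ A x)⁻¹ = 1 :=
    PowerSeries.mul_inv_cancel _ (by simp [constantCoeff_partitionSeries])
  rw [hg.partitionSeries_insert hV, add_mul, hinv, add_sub_cancel_left, mul_comm,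
    mul_integralSeries]
  · refine congrArg (integralSeries (Measure.pi ν)) (funext fun y => ?_)
    ring
  · intro r
    refine Integrable.of_bound (hg.measurable_coeff_insert_integrand ℬ V A x r).aestronglyMeasurable
      (∑ p ∈ Finset.HasAntidiagonal.antidiagonal r, ((φ V) ^ p.1 / (Nat.factorial p.1 : ℝ) + 1) *
        ((∑ V ∈ ℬ, φ V) ^ p.2 / (Nat.factorial p.2 : ℝ))) (Filter.Eventually.of_forall fun y => ?_)
    rw [PowerSeries.coeff_mul]
    refine norm_sum_le_of_le _ fun p _ => ?_
    rw [norm_mul]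
    refine mul_le_mul ?_ (hg.norm_coeff_partitionSeries_le ℬ _ _ _) (norm_nonneg _) ?_
    · rw [map_sub, PowerSeries.coeff_one]
      refine (norm_sub_le _ _).trans (add_le_add ?_ ?_)
      · simpa using hg.norm_coeff_expSeries_sum_le {V} p.1 (replaceOn A x y)
      · split_ifs <;> simp
    · have : 0 ≤ φ V := (norm_nonneg _).trans (hg.norm_le V x)
      positivity

end IsInteraction

end Interaction

/-! ### Weights of sets of coordinates -/

section Weights

variable {n : ℕ}

/-- The smallness condition on the norms `φ V` of an interaction, with `q + 1` binomial moments,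
together with the range of the scale `R` at which power series are measured. -/
structure IsSmall (φ : Finset (Fin n) → ℝ) (q : ℕ) (α R : ℝ) : Prop where
  nonneg : ∀ V, 0 ≤ φ V
  alpha_nonneg : 0 ≤ α
  alpha_le : α ≤ 1 / 100
  one_le_R : 1 ≤ R
  R_mul_alpha_le : 16 * (R * α) ≤ 1
  moment_le : ∀ j, ∀ t ≤ q, 2 ^ (t + 1) * ∑ V with j ∈ V,
    φ V * Real.exp (3 / 2 * α * V.card) * ((V.card - 1).choose t : ℝ) ≤ α

/-- Bound at truncation level `0`, i.e. in the unweighted `ℓ¹` norm, for the relative change caused by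
the term `g V`. -/
noncomputable def weightZero (φ : Finset (Fin n) → ℝ) (α : ℝ) (V : Finset (Fin n)) : ℝ :=
  φ V * Real.exp (3 / 2 * α * V.card)

/-- Bound at truncation level `q + 1` for the relative change caused by the term `g V`. The binomial
sum starts from `|V| - 1`, at the price of the factor `5 / 4` that turns `16 / 15` into `4 / 3`. -/
noncomputable def weightMid (φ : Finset (Fin n) → ℝ) (q : ℕ) (α R : ℝ) (V : Finset (Fin n)) : ℝ :=
  4 / 3 * R * weightZero φ α V * truncBinom (V.card - 1) q (1 / 4)

/-- Bound at truncation level `q + 2` for the relative change caused by the term `g V`. -/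
noncomputable def weightTop (φ : Finset (Fin n) → ℝ) (q : ℕ) (α R : ℝ) (V : Finset (Fin n)) : ℝ :=
  16 / 15 * R * weightZero φ α V * truncBinom V.card (q + 1) (1 / 4)

namespace IsSmall

variable {φ : Finset (Fin n) → ℝ} {q : ℕ} {α R : ℝ} (h : IsSmall φ q α R)
include h

lemma R_nonneg : 0 ≤ R := zero_le_one.trans h.one_le_R

lemma weightZero_nonneg (V : Finset (Fin n)) : 0 ≤ weightZero φ α V :=
  mul_nonneg (h.nonneg V) (Real.exp_pos _).le

lemma weightMid_nonneg (V : Finset (Fin n)) : 0 ≤ weightMid φ q α R V :=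
  mul_nonneg (mul_nonneg (mul_nonneg (by norm_num) h.R_nonneg) (h.weightZero_nonneg V))
    (truncBinom_nonneg (by norm_num) _ _)

lemma sum_choose_le (j : Fin n) {t : ℕ} (ht : t ≤ q) :
    ∑ V with j ∈ V, weightZero φ α V * ((V.card - 1).choose t : ℝ) ≤ α / 2 ^ (t + 1) := by
  rw [le_div_iff₀ (by positivity), mul_comm]
  exact h.moment_le j t ht

lemma sum_weightZero_le (j : Fin n) : ∑ V with j ∈ V, weightZero φ α V ≤ α / 2 := by
  simpa using h.sum_choose_le j (Nat.zero_le q)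

lemma sum_geom_le (j : Fin n) : ∑ t ∈ Finset.range (q + 1),
    (∑ V with j ∈ V, weightZero φ α V * ((V.card - 1).choose t : ℝ)) * (1 / 4) ^ t ≤
      4 / 7 * α := by
  calc _ ≤ ∑ t ∈ Finset.range (q + 1), α / 2 * (1 / 8) ^ t := by
        refine Finset.sum_le_sum fun t ht => ?_
        rw [Finset.mem_range] at ht
        refine (mul_le_mul_of_nonneg_right (h.sum_choose_le j (t := t) (by omega))
          (by positivity)).trans (le_of_eq ?_)
        rw [pow_succ, show (1 / 8 : ℝ) = 1 / 2 * (1 / 4) by norm_num, mul_pow, one_div_pow 2]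
        field_simp
    _ ≤ _ := by
        rw [← Finset.mul_sum]
        have h1 := geom_sum_mul_neg (1 / 8 : ℝ) (q + 1)
        have h2 : (0 : ℝ) ≤ (1 / 8) ^ (q + 1) := by positivity
        have h3 : ∑ t ∈ Finset.range (q + 1), (1 / 8 : ℝ) ^ t ≤ 8 / 7 := by linarith
        have := mul_le_mul_of_nonneg_left h3 h.alpha_nonneg
        linarith

lemma sum_weightMid_le (j : Fin n) : ∑ V with j ∈ V, weightMid φ q α R V ≤ 1 / 20 := by
  have h1 := h.sum_geom_le j
  have h2 : ∑ V with j ∈ V, weightMid φ q α R V = 4 / 3 * R * ∑ t ∈ Finset.range (q + 1),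
      (∑ V with j ∈ V, weightZero φ α V * ((V.card - 1).choose t : ℝ)) * (1 / 4) ^ t := by
    simp only [weightMid, truncBinom, Finset.mul_sum, Finset.sum_mul]
    rw [Finset.sum_comm]
    refine Finset.sum_congr rfl fun t _ => Finset.sum_congr rfl fun V _ => ?_
    ring
  rw [h2]
  have h3 := mul_le_mul_of_nonneg_left h1 (mul_nonneg (by norm_num : (0 : ℝ) ≤ 4 / 3) h.R_nonneg)
  linarith [h.R_mul_alpha_le]

lemma norm_le {V : Finset (Fin n)} (hV : V.Nonempty) : φ V ≤ α / 2 := by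
  obtain ⟨j, hj⟩ := hV
  refine le_trans ?_ (h.sum_weightZero_le j)
  refine le_trans ?_ (Finset.single_le_sum (f := weightZero φ α)
    (fun V _ => h.weightZero_nonneg V) (a := V) (by simp [hj]))
  refine le_mul_of_one_le_right (h.nonneg V) (Real.one_le_exp ?_)
  have := h.alpha_nonneg
  positivity

/-- Sharing out the weight of each set equally among its elements, `C(k, t + 1) / k` is at most
`C(k - 1, t)`, so that `q + 1` binomial moments control the truncation level `q + 2`. -/
lemma sum_weightTop_le {𝒱 : Finset (Finset (Fin n))} (h𝒱 : ∀ V ∈ 𝒱, V.Nonempty) :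
    ∑ V ∈ 𝒱, weightTop φ q α R V ≤ n / 20 := by
  have hR := h.R_nonneg
  have share : ∀ V ∈ 𝒱, weightTop φ q α R V =
      ∑ j, if j ∈ V then weightTop φ q α R V / V.card else 0 := by
    intro V hV
    have hc : (V.card : ℝ) ≠ 0 := by exact_mod_cast (Finset.card_pos.2 (h𝒱 V hV)).ne'
    rw [Finset.sum_ite_mem, Finset.univ_inter, Finset.sum_const, nsmul_eq_mul]
    field_simp
  rw [Finset.sum_congr rfl share, Finset.sum_comm]
  suffices hj : ∀ j : Fin n, ∑ V ∈ 𝒱, (if j ∈ V then weightTop φ q α R V / V.card else 0) ≤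
      1 / 20 by
    refine (Finset.sum_le_sum fun j _ => hj j).trans ?_
    simp [div_eq_mul_inv]
  intro j
  have hterm : ∀ V : Finset (Fin n), j ∈ V → weightTop φ q α R V / V.card ≤
      16 / 15 * R * (weightZero φ α V + 1 / 4 * (weightZero φ α V *
        truncBinom (V.card - 1) q (1 / 4))) := by
    intro V hV
    have hc : 0 < V.card := Finset.card_pos.2 ⟨j, hV⟩
    obtain ⟨k, hk⟩ : ∃ k, V.card = k + 1 := ⟨V.card - 1, by omega⟩
    have hw := h.weightZero_nonneg V
    have hb : truncBinom (k + 1) (q + 1) (1 / 4) ≤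
        (1 + 1 / 4 * truncBinom k q (1 / 4)) * ((k + 1 : ℕ) : ℝ) := by
      rw [truncBinom, Finset.sum_range_succ', truncBinom, add_mul, add_comm, Finset.mul_sum,
        Finset.sum_mul]
      refine add_le_add (by simp) (Finset.sum_le_sum fun t _ => ?_)
      have h1 : (k + 1).choose (t + 1) ≤ k.choose t * (k + 1) := by
        rw [mul_comm, Nat.add_one_mul_choose_eq]
        exact Nat.le_mul_of_pos_right _ (Nat.succ_pos t)
      have h2 : ((k + 1).choose (t + 1) : ℝ) ≤ k.choose t * ((k + 1 : ℕ) : ℝ) := by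
        exact_mod_cast h1
      calc _ ≤ (k.choose t * ((k + 1 : ℕ) : ℝ)) * (1 / 4) ^ (t + 1) := by gcongr
        _ = _ := by rw [pow_succ]; ring
    rw [div_le_iff₀ (by exact_mod_cast hc), weightTop, hk, Nat.add_sub_cancel]
    calc _ ≤ 16 / 15 * R * weightZero φ α V *
          ((1 + 1 / 4 * truncBinom k q (1 / 4)) * ((k + 1 : ℕ) : ℝ)) := by gcongr
      _ = _ := by ring
  rw [← Finset.sum_filter]
  calc _ ≤ ∑ V with j ∈ V, 16 / 15 * R * (weightZero φ α V + 1 / 4 * (weightZero φ α V *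
        truncBinom (V.card - 1) q (1 / 4))) := by
        refine (Finset.sum_le_sum fun V hV => hterm V (Finset.mem_filter.1 hV).2).trans ?_
        refine Finset.sum_le_sum_of_subset_of_nonneg
          (Finset.filter_subset_filter _ (Finset.subset_univ _)) fun V _ _ => ?_
        have h1 := h.weightZero_nonneg V
        have h2 := truncBinom_nonneg (y := 1 / 4) (by norm_num) (V.card - 1) q
        positivity
    _ = 16 / 15 * R * (∑ V with j ∈ V, weightZero φ α V) +
        1 / 5 * ∑ V with j ∈ V, weightMid φ q α R V := by
        rw [Finset.mul_sum, Finset.mul_sum, ← Finset.sum_add_distrib]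
        refine Finset.sum_congr rfl fun V _ => ?_
        rw [weightMid]
        ring
    _ ≤ 1 / 20 := by
        have h1 := mul_le_mul_of_nonneg_left (h.sum_weightZero_le j)
          (mul_nonneg (by norm_num : (0 : ℝ) ≤ 16 / 15) hR)
        have h2 := h.sum_weightMid_le j
        linarith [h.R_mul_alpha_le]

end IsSmall

end Weights

/-! ### Induction on the interaction -/

section Induction

variable {n : ℕ} {Ω : Fin n → Type*} [∀ i, MeasurableSpace (Ω i)] {ν : ∀ i, Measure (Ω i)}
  {g : Finset (Fin n) → (∀ i, Ω i) → ℂ}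
  {φ : Finset (Fin n) → ℝ} {q : ℕ} {α R : ℝ}

/-- Adding one term to the family `𝒱` changes the partition series by a relative amount controlled
by the weights, whichever coordinates are frozen. -/
def RatioBound (ν : ∀ i, Measure (Ω i)) (g : Finset (Fin n) → (∀ i, Ω i) → ℂ)
    (φ : Finset (Fin n) → ℝ) (q : ℕ) (α R : ℝ) (𝒱 : Finset (Finset (Fin n))) : Prop :=
  ∀ V ∉ 𝒱, V.Nonempty → ∀ A x,
    NormLE R 0 (partitionSeries ν g (insert V 𝒱) A x * (partitionSeries ν g 𝒱 A x)⁻¹ - 1)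
      (weightZero φ α V) ∧
    NormLE R (q + 1) (partitionSeries ν g (insert V 𝒱) A x * (partitionSeries ν g 𝒱 A x)⁻¹ - 1)
      (weightMid φ q α R V)

lemma PowerSeries.mul_inv_mul_inv_comm (a b c d : PowerSeries ℂ) :
    a * c⁻¹ * (b * d⁻¹)⁻¹ = a * b⁻¹ * (c * d⁻¹)⁻¹ := by
  rw [PowerSeries.mul_inv_rev, PowerSeries.mul_inv_rev]
  ring

/-- The change of the quotient of two partition series under an additional term, from the changes of
both; the constant is `9 / 4 = 1 + 5 / 4`, the second summand coming from an inverse. -/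
lemma NormLE.ratio_exp {R : ℝ} (hR : 1 ≤ R) {p : ℕ} {a b c d : PowerSeries ℂ} {w : ℝ}
    (hc : PowerSeries.constantCoeff c = 1) (hd : PowerSeries.constantCoeff d = 1)
    (h1 : NormLE R p (a * b⁻¹ - 1) w) (h2 : NormLE R p (c * d⁻¹ - 1) w) (hw : w ≤ 1 / 10) :
    NormLE R p (a * c⁻¹ * (b * d⁻¹)⁻¹ - 1) (Real.exp (9 / 4 * w) - 1) := by
  have hw0 := h1.nonneg
  have he : w ≤ Real.exp w - 1 := by linarith [Real.add_one_le_exp w]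
  rw [PowerSeries.mul_inv_mul_inv_comm, show 9 / 4 * w = w + 5 / 4 * w by ring]
  exact (h1.mono he).mul_sub_one ((h2.mono he).inv_sub_one_exp (by simp [hc, hd]) hw0 hw hR) hR

variable [∀ i, IsProbabilityMeasure (ν i)]

/-- Freezing the coordinates in `V` multiplies the partition series by a bounded factor, the bound
being a truncated binomial sum in `|V|`. -/
lemma freeze_ratio_le (hg : IsInteraction g φ) (h : IsSmall φ q α R)
    {𝒱 : Finset (Finset (Fin n))} (h𝒱 : ∀ W ∈ 𝒱, W.Nonempty)
    (ih : ∀ ℬ ⊂ 𝒱, RatioBound ν g φ q α R ℬ) (V A : Finset (Fin n)) {x w : ∀ i, Ω i}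
    (hw : ∀ i ∉ A, w i = x i) {p : ℕ} (hp : p ≤ q + 1) :
    NormLE R p (partitionSeries ν g 𝒱 (A \ V) w * (partitionSeries ν g 𝒱 A x)⁻¹)
      (Real.exp (9 / 8 * α * V.card) * truncBinom V.card p (1 / 4)) := by
  have hR := h.one_le_R
  set D : Finset (Finset (Fin n)) → PowerSeries ℂ := fun ℬ =>
    partitionSeries ν g ℬ (A \ V) w * (partitionSeries ν g ℬ A x)⁻¹ with hD
  have hD1 : ∀ ℬ, PowerSeries.constantCoeff (D ℬ) = 1 := by
    simp [hD, constantCoeff_partitionSeries]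
  have hmid : ∀ W ∈ 𝒱, weightMid φ q α R W ≤ 1 / 10 := by
    intro W hW
    obtain ⟨j, hj⟩ := h𝒱 W hW
    have := Finset.single_le_sum (f := weightMid φ q α R)
      (fun V _ => h.weightMid_nonneg V) (a := W) (s := {W | j ∈ W}) (by simp [hj])
    linarith [h.sum_weightMid_le j]
  have hzero : ∀ W ∈ 𝒱, weightZero φ α W ≤ 1 / 10 := by
    intro W hW
    obtain ⟨j, hj⟩ := h𝒱 W hW
    have := Finset.single_le_sum (f := weightZero φ α)
      (fun V _ => h.weightZero_nonneg V) (a := W) (s := {W | j ∈ W}) (by simp [hj])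
    linarith [h.sum_weightZero_le j, h.alpha_le]
  have hss : ∀ ℬ ⊆ 𝒱, ∀ W ∈ 𝒱, W ∉ ℬ → ℬ ⊂ 𝒱 := fun ℬ hℬ W hW hW' =>
    Finset.ssubset_iff_subset_ne.2 ⟨hℬ, fun he => hW' (he ▸ hW)⟩
  have hstep1 : ∀ ℬ ⊆ 𝒱, ∀ W ∈ 𝒱, W ∉ ℬ → NormLE R (q + 1) (D (insert W ℬ) * (D ℬ)⁻¹ - 1)
      (Real.exp (9 / 4 * weightMid φ q α R W) - 1) := fun ℬ hℬ W hW hW' =>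
    NormLE.ratio_exp hR (constantCoeff_partitionSeries ν _ _ _)
      (constantCoeff_partitionSeries ν _ _ _)
      (ih ℬ (hss ℬ hℬ W hW hW') W hW' (h𝒱 W hW) _ _).2
      (ih ℬ (hss ℬ hℬ W hW hW') W hW' (h𝒱 W hW) _ _).2 (hmid W hW)
  have hstep0 : ∀ ℬ ⊆ 𝒱, ∀ W ∈ 𝒱, W ∉ ℬ → NormLE R 0 (D (insert W ℬ) * (D ℬ)⁻¹ - 1)
      (Real.exp (9 / 4 * weightZero φ α W) - 1) := fun ℬ hℬ W hW hW' =>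
    NormLE.ratio_exp hR (constantCoeff_partitionSeries ν _ _ _)
      (constantCoeff_partitionSeries ν _ _ _)
      (ih ℬ (hss ℬ hℬ W hW hW') W hW' (h𝒱 W hW) _ _).1
      (ih ℬ (hss ℬ hℬ W hW hW') W hW' (h𝒱 W hW) _ _).1 (hzero W hW)
  -- Releasing the point `j` adds only sets that contain `j`.
  have hsplit : ∀ (K : Finset (Fin n)) (j : Fin n), ({W ∈ 𝒱 | Disjoint W K} : Finset _) =
      {W ∈ 𝒱 | Disjoint W (insert j K)} ∪ {W ∈ 𝒱 | Disjoint W K ∧ j ∈ W} := by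
    intro K j
    ext W
    simp only [Finset.mem_filter, Finset.mem_union, Finset.disjoint_insert_right]
    tauto
  have hdisj : ∀ (K : Finset (Fin n)) (j : Fin n),
      Disjoint ({W ∈ 𝒱 | Disjoint W (insert j K)} : Finset _) {W ∈ 𝒱 | Disjoint W K ∧ j ∈ W} := by
    intro K j
    rw [Finset.disjoint_left]
    intro W hW hW'
    simp only [Finset.mem_filter, Finset.disjoint_insert_right] at hW hW'
    exact hW.2.1 hW'.2.2
  have hsub : ∀ (K : Finset (Fin n)) (j : Fin n),
      ({W ∈ 𝒱 | Disjoint W K ∧ j ∈ W} : Finset _) ⊆ Finset.univ.filter (j ∈ ·) := by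
    intro K j W hW
    simp only [Finset.mem_filter] at hW
    simpa using hW.2.2
  have hm : ∀ (K : Finset (Fin n)) (j : Fin n), NormLE R (q + 1)
      (D {W ∈ 𝒱 | Disjoint W K} * (D {W ∈ 𝒱 | Disjoint W (insert j K)})⁻¹ - 1) (1 / 4) := by
    intro K j
    have h1 := NormLE.union_ratio hR hD1 hstep1
      (Finset.filter_subset (fun W => Disjoint W (insert j K)) 𝒱)
      (Finset.filter_subset (fun W => Disjoint W K ∧ j ∈ W) 𝒱) (hdisj K j)
    rw [← hsplit K j] at h1
    refine h1.mono ?_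
    rw [← Finset.mul_sum]
    set s := 9 / 4 * ∑ W ∈ 𝒱 with Disjoint W K ∧ j ∈ W, weightMid φ q α R W
    have h2 : s ≤ 9 / 80 := by
      have := Finset.sum_le_sum_of_subset_of_nonneg (hsub K j)
        fun W _ _ => h.weightMid_nonneg W
      have := h.sum_weightMid_le j
      simp only [s]
      linarith
    have h3 : Real.exp s ≤ Real.exp (9 / 80) := Real.exp_le_exp.2 h2
    have h4 := Real.abs_exp_sub_one_sub_id_le (x := 9 / 80) (by norm_num [abs_le])
    linarith [(abs_le.1 h4).2]
  have h0 : ∀ (K : Finset (Fin n)) (j : Fin n), NormLE R 0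
      (D {W ∈ 𝒱 | Disjoint W K} * (D {W ∈ 𝒱 | Disjoint W (insert j K)})⁻¹ - 1)
        (Real.exp (9 / 8 * α) - 1) := by
    intro K j
    have h1 := NormLE.union_ratio hR hD1 hstep0
      (Finset.filter_subset (fun W => Disjoint W (insert j K)) 𝒱)
      (Finset.filter_subset (fun W => Disjoint W K ∧ j ∈ W) 𝒱) (hdisj K j)
    rw [← hsplit K j] at h1
    refine h1.mono (sub_le_sub_right (Real.exp_le_exp.2 ?_) _)
    rw [← Finset.mul_sum]
    have := Finset.sum_le_sum_of_subset_of_nonneg (hsub K j)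
        fun W _ _ => h.weightZero_nonneg W
    have := h.sum_weightZero_le j
    linarith
  have hfin := NormLE.ratio_filter_disjoint hR hD1 (by norm_num)
    (mul_nonneg (by norm_num) h.alpha_nonneg) hm h0 V p hp
  -- The terms that do not meet `V` do not feel that `V` is frozen.
  have hone : D {W ∈ 𝒱 | Disjoint W V} = 1 := by
    have : partitionSeries ν g {W ∈ 𝒱 | Disjoint W V} (A \ V) w =
        partitionSeries ν g {W ∈ 𝒱 | Disjoint W V} A x := by
      refine hg.partitionSeries_congr fun W hW i hi => ?_
      have hiV : i ∉ V := Finset.disjoint_left.1 (Finset.mem_filter.1 hW).2 hi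
      exact ⟨by simp [hiV], fun hA => hw i (by simpa [hiV] using hA)⟩
    rw [hD]
    simp only [this]
    exact PowerSeries.mul_inv_cancel _ (by simp [constantCoeff_partitionSeries])
  have hinv1 : (1 : PowerSeries ℂ)⁻¹ = 1 := by
    rw [PowerSeries.inv_eq_iff_mul_eq_one (by simp), mul_one]
  rwa [hone, hinv1, mul_one] at hfin

/-- One induction step: bounds on freezing ratios bound the effect of an additional term. -/
lemma insert_ratio_le (hg : IsInteraction g φ) (h : IsSmall φ q α R)
    {𝒱 : Finset (Finset (Fin n))} (h𝒱 : ∀ W ∈ 𝒱, W.Nonempty)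
    (ih : ∀ ℬ ⊂ 𝒱, RatioBound ν g φ q α R ℬ) {V : Finset (Fin n)} (hV : V ∉ 𝒱)
    (hVne : V.Nonempty) (A : Finset (Fin n)) (x : ∀ i, Ω i) :
    NormLE R 0 (partitionSeries ν g (insert V 𝒱) A x * (partitionSeries ν g 𝒱 A x)⁻¹ - 1)
      (weightZero φ α V) ∧
    ∀ p ≤ q + 1, NormLE R (p + 1)
      (partitionSeries ν g (insert V 𝒱) A x * (partitionSeries ν g 𝒱 A x)⁻¹ - 1)
      (16 / 15 * R * weightZero φ α V * truncBinom V.card p (1 / 4)) := by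
  have hR := h.one_le_R
  have hα := h.alpha_nonneg
  have hφ := h.norm_le hVne
  have hφ0 := h.nonneg V
  have hα1 := h.alpha_le
  have hcard : (1 : ℝ) ≤ V.card := by exact_mod_cast Finset.card_pos.2 hVne
  have hfr : ∀ y p, p ≤ q + 1 → NormLE R p (partitionSeries ν g 𝒱 (A \ V) (replaceOn A x y) *
      (partitionSeries ν g 𝒱 A x)⁻¹)
      (Real.exp (9 / 8 * α * V.card) * truncBinom V.card p (1 / 4)) := fun y p hp =>
    freeze_ratio_le hg h h𝒱 ih V A (fun i hi => by simp [replaceOn, hi]) hp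
  have hmeas : ∀ r, Measurable fun y => PowerSeries.coeff r
      ((PowerSeries.expSeries (g V (replaceOn A x y)) - 1) *
          (partitionSeries ν g 𝒱 (A \ V) (replaceOn A x y) * (partitionSeries ν g 𝒱 A x)⁻¹)) := by
    intro r
    simp only [← mul_assoc]
    exact measurable_coeff_mul (hg.measurable_coeff_insert_integrand 𝒱 V A x)
      (fun _ => measurable_const) r
  rw [hg.partitionSeries_insert_ratio hV]
  constructor
  · refine NormLE.integralSeries hR hmeas fun y => ?_
    have h1 := (NormLE.one_iff (R := R)).1 (PowerSeries.normLE_expSeries_sub_one le_rfl 0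
      (hg.norm_le V (replaceOn A x y)) (by linarith : 1 * φ V < 2))
    refine (h1.mul (hfr y 0 (by omega)) hR).mono ?_
    rw [truncBinom_zero_right, mul_one, one_mul, weightZero,
      show 3 / 2 * α * (V.card : ℝ) = 3 / 8 * α * V.card + 9 / 8 * α * V.card by ring,
      Real.exp_add, ← mul_assoc]
    refine mul_le_mul_of_nonneg_right ?_ (Real.exp_pos _).le
    rw [div_eq_mul_one_div]
    refine mul_le_mul_of_nonneg_left ?_ hφ0
    have h2 : 1 + 3 / 8 * α ≤ Real.exp (3 / 8 * α * V.card) := by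
      have := Real.add_one_le_exp (3 / 8 * α * V.card)
      have := le_mul_of_one_le_right (by positivity : 0 ≤ 3 / 8 * α) hcard
      linarith
    refine le_trans ?_ h2
    rw [div_le_iff₀ (by linarith)]
    nlinarith
  · intro p hp
    refine NormLE.integralSeries hR hmeas fun y => ?_
    have hRφ : R * φ V ≤ 1 / 32 := by
      have := mul_le_mul_of_nonneg_left hφ h.R_nonneg
      linarith [h.R_mul_alpha_le]
    have hRφ0 : 0 ≤ R * φ V := mul_nonneg h.R_nonneg hφ0
    have h1 := PowerSeries.normLE_expSeries_sub_one hR (p + 1)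
      (hg.norm_le V (replaceOn A x y)) (by linarith)
    refine (h1.mul_succ (by simp [PowerSeries.constantCoeff_expSeries]) (hfr y p hp) hR).mono ?_
    have h2 : R * φ V / (1 - R * φ V / 2) ≤ 16 / 15 * (R * φ V) := by
      rw [div_le_iff₀ (by linarith)]
      nlinarith
    have h3 : Real.exp (9 / 8 * α * V.card) ≤ Real.exp (3 / 2 * α * V.card) := by
      refine Real.exp_le_exp.2 (mul_le_mul_of_nonneg_right ?_ (by positivity))
      linarith
    have h4 := truncBinom_nonneg (y := 1 / 4) (by norm_num) V.card p
    calc _ ≤ 16 / 15 * (R * φ V) *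
          (Real.exp (3 / 2 * α * V.card) * truncBinom V.card p (1 / 4)) := by gcongr
      _ = _ := by rw [weightZero]; ring

lemma ratioBound (hg : IsInteraction g φ) (h : IsSmall φ q α R)
    (𝒱 : Finset (Finset (Fin n))) (h𝒱 : ∀ W ∈ 𝒱, W.Nonempty) : RatioBound ν g φ q α R 𝒱 := by
  induction 𝒱 using Finset.strongInduction with
  | H 𝒱 ih =>
    intro V hV hVne A x
    obtain ⟨h1, h2⟩ := insert_ratio_le hg h h𝒱
      (fun ℬ hℬ => ih ℬ hℬ fun W hW => h𝒱 W (hℬ.subset hW)) hV hVne A x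
    refine ⟨h1, (h2 q (by omega)).mono ?_⟩
    have hk : V.card = (V.card - 1) + 1 := by
      have := Finset.card_pos.2 hVne
      omega
    have h3 : truncBinom V.card q (1 / 4) ≤ (1 + 1 / 4) * truncBinom (V.card - 1) q (1 / 4) := by
      conv_lhs => rw [hk]
      exact truncBinom_succ_le (by norm_num) _ _
    have h4 := h.weightZero_nonneg V
    have h5 := h.R_nonneg
    calc _ ≤ 16 / 15 * R * weightZero φ α V *
          ((1 + 1 / 4) * truncBinom (V.card - 1) q (1 / 4)) := by gcongr
      _ = _ := by rw [weightMid]; ring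

/-- The logarithm of the partition series is a sum of logarithms of ratios, one for each term; this
bounds its coefficients and shows that it sums up to a logarithm of the value at `1`. -/
lemma logOf_partitionSeries (hg : IsInteraction g φ) (h : IsSmall φ q α R)
    (𝒱 : Finset (Finset (Fin n))) (h𝒱 : ∀ W ∈ 𝒱, W.Nonempty) (A : Finset (Fin n)) (x : ∀ i, Ω i) :
    NormLE R (q + 2) (PowerSeries.logOf (partitionSeries ν g 𝒱 A x))
      (∑ V ∈ 𝒱, 20 / 19 * weightTop φ q α R V) ∧
    Complex.exp (PowerSeries.coeffSum (PowerSeries.logOf (partitionSeries ν g 𝒱 A x))) =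
      PowerSeries.coeffSum (partitionSeries ν g 𝒱 A x) := by
  have hR := h.one_le_R
  induction 𝒱 using Finset.induction_on with
  | empty =>
    have : PowerSeries.logOf (1 : PowerSeries ℂ) = 0 :=
      PowerSeries.logOf_eq_of_derivative (by simp) (by simp) (by simp)
    rw [partitionSeries_empty, this]
    exact ⟨by simpa using NormLE.zero, by simp [PowerSeries.coeffSum]⟩
  | insert V 𝒱 hV ih =>
    have h𝒱' : ∀ W ∈ 𝒱, W.Nonempty := fun W hW => h𝒱 W (by simp [hW])
    have hVne : V.Nonempty := h𝒱 V (by simp)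
    obtain ⟨ih1, ih2⟩ := ih h𝒱'
    set Z := partitionSeries ν g 𝒱 A x with hZ
    have hZ1 : PowerSeries.constantCoeff Z = 1 := constantCoeff_partitionSeries ν _ _ _
    set f := partitionSeries ν g (insert V 𝒱) A x * Z⁻¹ with hf
    have hf1 : PowerSeries.constantCoeff f = 1 := by
      simp [hf, hZ1, constantCoeff_partitionSeries]
    have hprod : partitionSeries ν g (insert V 𝒱) A x = f * Z := by
      rw [hf, mul_assoc, PowerSeries.inv_mul_cancel _ (by simp [hZ1]), mul_one]
    have hb := insert_ratio_le hg h h𝒱'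
      (fun ℬ hℬ => ratioBound (ν := ν) hg h ℬ fun W hW => h𝒱' W (hℬ.subset hW)) hV hVne A x
    have htop : NormLE R (q + 2) (f - 1) (weightTop φ q α R V) := hb.2 (q + 1) le_rfl
    have hmid := (ratioBound (ν := ν) hg h 𝒱 h𝒱' V hV hVne A x).2
    obtain ⟨j, hj⟩ := hVne
    have hmid' : weightMid φ q α R V ≤ 1 / 20 := by
      refine le_trans ?_ (h.sum_weightMid_le j)
      exact Finset.single_le_sum (f := weightMid φ q α R)
        (fun V _ => h.weightMid_nonneg V) (by simp [hj])
    have hmid1 : NormLE R (q + 1) (f - 1) (1 / 20) := hmid.mono hmid'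
    have hlog : NormLE R (q + 2) (PowerSeries.logOf f) (20 / 19 * weightTop φ q α R V) :=
      (htop.logOf hmid1 hf1 (by norm_num) hR).mono (le_of_eq (by ring))
    have hlog0 := (hlog.of_le hR (Nat.zero_le _)).summable
    have hmid0 := hmid1.of_le hR (Nat.zero_le _)
    have hf0 : Summable fun r => ‖PowerSeries.coeff r f‖ := by
      have : NormLE R 0 f (1 / 20 + 1) := by simpa using hmid0.add NormLE.one hR
      exact this.summable
    have hZ0 : Summable fun r => ‖PowerSeries.coeff r Z‖ :=
      Summable.of_nonneg_of_le (fun _ => norm_nonneg _)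
        (hg.norm_coeff_partitionSeries_le 𝒱 A x) (Real.summable_pow_div_factorial _)
    rw [hprod, PowerSeries.logOf_mul hf1 hZ1, Finset.sum_insert hV]
    refine ⟨hlog.add ih1 hR, ?_⟩
    rw [PowerSeries.coeffSum_add hlog0 (ih1.of_le hR (Nat.zero_le _)).summable, Complex.exp_add,
      ih2, PowerSeries.exp_coeffSum_logOf hR hmid0 hf1 (by norm_num),
      PowerSeries.coeffSum_mul hf0 hZ0]

end Induction

/-! ### The centred decomposition of a function of independent variables -/

section Decomposition

variable {S : Type*} [MeasurableSpace S] (P : Measure S) {n : ℕ} {Ω : Fin n → Type*}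
  (X : ∀ i, S → Ω i) (f : (∀ i, Ω i) → ℂ)

/-- The component of `f` at the set `V` of coordinates in its Hoeffding decomposition. -/
noncomputable def hoeffdingComponent (V : Finset (Fin n)) (x : ∀ i, Ω i) : ℂ :=
  (-1) ^ V.card *
    ∫ s, ∑ W ∈ V.powerset, (-1 : ℂ) ^ W.card * f (replaceOn W (fun i => X i s) x) ∂P

/-- Möbius inversion on the Boolean lattice. -/
lemma sum_neg_one_pow_card_mul_sum_powerset (h : Finset (Fin n) → ℂ) :
    ∑ V : Finset (Fin n), (-1 : ℂ) ^ V.card * ∑ W ∈ V.powerset, (-1) ^ W.card * h W =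
      h Finset.univ := by
  have h1 : ∀ W : Finset (Fin n), ∑ V with W ⊆ V, (-1 : ℂ) ^ V.card * (-1) ^ W.card =
      if W = Finset.univ then 1 else 0 := by
    intro W
    have h2 : ∑ V with W ⊆ V, (-1 : ℂ) ^ V.card * (-1) ^ W.card =
        ∑ U ∈ (Wᶜ).powerset, (-1 : ℂ) ^ U.card := by
      refine Finset.sum_nbij' (fun V => V \ W) (fun U => U ∪ W) ?_ ?_ ?_ ?_ ?_
      · intro V _
        rw [Finset.mem_powerset]
        intro i hi
        simpa using (Finset.mem_sdiff.1 hi).2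
      · intro U _
        simp
      · intro V hV
        exact Finset.sdiff_union_of_subset (Finset.mem_filter.1 hV).2
      · intro U hU
        rw [Finset.mem_powerset] at hU
        refine Finset.union_sdiff_cancel_right ?_
        exact Finset.disjoint_left.2 fun i hi => by simpa using hU hi
      · intro V hV
        have := Finset.card_sdiff_add_card_eq_card (Finset.mem_filter.1 hV).2
        rw [← this, pow_add, mul_assoc, ← mul_pow]
        simp
    rw [h2]
    have h3 := congrArg (Int.cast (R := ℂ)) (Finset.sum_powerset_neg_one_pow_card (x := Wᶜ))
    push_cast at h3
    rw [h3]
    simp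
  calc _ = ∑ V : Finset (Fin n), ∑ W : Finset (Fin n),
        if W ⊆ V then (-1 : ℂ) ^ V.card * (-1) ^ W.card * h W else 0 := by
        refine Finset.sum_congr rfl fun V _ => ?_
        rw [Finset.mul_sum, ← Finset.sum_filter]
        refine Finset.sum_congr ?_ fun W _ => by ring
        ext W
        simp
    _ = ∑ W : Finset (Fin n), (if W = Finset.univ then 1 else 0) * h W := by
        rw [Finset.sum_comm]
        refine Finset.sum_congr rfl fun W _ => ?_
        rw [← h1 W, Finset.sum_mul, Finset.sum_filter]
    _ = _ := by simp

variable {P X f}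

lemma norm_hoeffdingComponent_le [IsProbabilityMeasure P] {C : ℝ} (hC : ∀ x, ‖f x‖ ≤ C)
    (V : Finset (Fin n)) (x : ∀ i, Ω i) : ‖hoeffdingComponent P X f V x‖ ≤ avgDiff P X f V := by
  rw [hoeffdingComponent, norm_mul, norm_pow, norm_neg, norm_one, one_pow, one_mul]
  refine le_ciSup (f := fun y => ‖∫ s, ∑ W ∈ V.powerset, (-1 : ℂ) ^ W.card *
    f (replaceOn W (fun i => X i s) y) ∂P‖) ⟨∑ _ ∈ V.powerset, C, ?_⟩ x
  rintro _ ⟨y, rfl⟩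
  refine (norm_integral_le_of_norm_le_const (C := ∑ _ ∈ V.powerset, C)
    (Filter.Eventually.of_forall fun s => norm_sum_le_of_le _ fun W _ => ?_)).trans (by simp)
  simpa using hC _

lemma avgDiff_nonneg (V : Finset (Fin n)) : 0 ≤ avgDiff P X f V :=
  Real.iSup_nonneg fun _ => norm_nonneg _

lemma sum_avgDiff_le_maxRowSum (k : ℕ) (j : Fin n) :
    ∑ V with j ∈ V ∧ V.card = k, avgDiff P X f V ≤ maxRowSum P X f k := by
  refine le_trans (le_of_eq (Finset.sum_congr ?_ fun _ _ => rfl)) (le_ciSup (f := fun j : Fin n =>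
    ∑ V ∈ (Finset.univ.powersetCard k).filter (fun V => j ∈ V), avgDiff P X f V)
    (Set.finite_range _).bddAbove j)
  ext V
  simp [Finset.mem_powersetCard, and_comm]

lemma isSmall_avgDiff {q : ℕ} {α R : ℝ} (hα0 : 0 ≤ α) (hα : α ≤ 1 / 100) (hR : 1 ≤ R)
    (hRα : 16 * (R * α) ≤ 1)
    (hS : ∀ t ∈ Finset.Icc 1 (q + 1), ∑ k ∈ Finset.Icc t n,
        Real.exp (3 * α * (k : ℝ) / 2) * 2 ^ t * ((k - 1).choose (t - 1) : ℝ) *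
          maxRowSum P X f k ≤ α) : IsSmall (avgDiff P X f) q α R where
  nonneg V := avgDiff_nonneg V
  alpha_nonneg := hα0
  alpha_le := hα
  one_le_R := hR
  R_mul_alpha_le := hRα
  moment_le j t ht := by
    -- Sets with at most `t` elements contribute nothing, the binomial coefficient being `0`.
    refine le_trans ?_ (hS (t + 1) (by simp; omega))
    have h1 : ∑ V : Finset (Fin n) with j ∈ V, avgDiff P X f V * Real.exp (3 / 2 * α * V.card) *
        ((V.card - 1).choose t : ℝ) = ∑ V : Finset (Fin n) with j ∈ V ∧ t + 1 ≤ V.card,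
          avgDiff P X f V * Real.exp (3 / 2 * α * V.card) * ((V.card - 1).choose t : ℝ) := by
      rw [← Finset.filter_filter, Finset.sum_filter_of_ne (s := ({V | j ∈ V} : Finset _))]
      intro V hV hne
      by_contra hlt
      have hpos : 0 < V.card := Finset.card_pos.2 ⟨j, (Finset.mem_filter.1 hV).2⟩
      exact hne (by rw [Nat.choose_eq_zero_of_lt (by omega)]; simp)
    rw [h1, ← Finset.sum_fiberwise_of_maps_to (g := Finset.card) (t := Finset.Icc (t + 1) n)
      fun V hV => Finset.mem_Icc.2 ⟨(Finset.mem_filter.1 hV).2.2, by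
        simpa using Finset.card_le_univ V⟩, Finset.mul_sum]
    refine Finset.sum_le_sum fun k hk => ?_
    rw [Nat.add_sub_cancel]
    calc _ = Real.exp (3 * α * (k : ℝ) / 2) * 2 ^ (t + 1) * ((k - 1).choose t : ℝ) *
          ∑ V : Finset (Fin n) with j ∈ V ∧ V.card = k, avgDiff P X f V := by
          rw [Finset.mul_sum, Finset.mul_sum, Finset.filter_filter]
          refine Finset.sum_congr ?_ ?_
          · ext V
            simp only [Finset.mem_filter, Finset.mem_univ, true_and]
            have := (Finset.mem_Icc.1 hk).1
            constructor
            · exact fun h => ⟨h.1.1, h.2⟩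
            · exact fun h => ⟨⟨h.1, h.2 ▸ this⟩, h.2⟩
          · intro V hV
            rw [(Finset.mem_filter.1 hV).2.2, show 3 / 2 * α * (k : ℝ) = 3 * α * k / 2 by ring]
            ring
      _ ≤ _ := mul_le_mul_of_nonneg_left (sum_avgDiff_le_maxRowSum k j) (by positivity)

variable [∀ i, MeasurableSpace (Ω i)] [IsProbabilityMeasure P]

lemma integrable_replaceOn (hX : ∀ i, Measurable (X i)) (hf : Measurable f) {C : ℝ}
    (hC : ∀ x, ‖f x‖ ≤ C) (W : Finset (Fin n)) (x : ∀ i, Ω i) :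
    Integrable (fun s => f (replaceOn W (fun i => X i s) x)) P :=
  Integrable.of_bound ((hf.comp (measurable_replaceOn_left W x)).comp
    (measurable_pi_lambda _ hX)).aestronglyMeasurable C (Filter.Eventually.of_forall fun _ => hC _)

lemma sum_hoeffdingComponent (hX : ∀ i, Measurable (X i)) (hf : Measurable f) {C : ℝ}
    (hC : ∀ x, ‖f x‖ ≤ C) (x : ∀ i, Ω i) :
    ∑ V : Finset (Fin n), hoeffdingComponent P X f V x = f x := by
  have h1 : ∀ V, hoeffdingComponent P X f V x = (-1) ^ V.card *
      ∑ W ∈ V.powerset, (-1) ^ W.card * ∫ s, f (replaceOn W (fun i => X i s) x) ∂P := by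
    intro V
    rw [hoeffdingComponent, integral_finsetSum _ fun W _ =>
      (integrable_replaceOn hX hf hC W x).const_mul _]
    simp only [integral_const_mul]
  simp_rw [h1]
  rw [sum_neg_one_pow_card_mul_sum_powerset]
  simp [replaceOn_univ]

lemma isInteraction_hoeffdingComponent (hX : ∀ i, Measurable (X i)) (hf : Measurable f) {C : ℝ}
    (hC : ∀ x, ‖f x‖ ≤ C) : IsInteraction (hoeffdingComponent P X f) (avgDiff P X f) where
  measurable V := by
    have h1 : ∀ W : Finset (Fin n), Measurable fun p : (∀ i, Ω i) × S =>
        f (replaceOn W (fun i => X i p.2) p.1) := fun W =>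
      hf.comp ((measurable_replaceOn W).comp
        (((measurable_pi_lambda _ hX).comp measurable_snd).prodMk measurable_fst))
    have h2 : Measurable fun p : (∀ i, Ω i) × S => ∑ W ∈ V.powerset, (-1 : ℂ) ^ W.card *
        f (replaceOn W (fun i => X i p.2) p.1) :=
      Finset.measurable_fun_sum _ fun W _ => (h1 W).const_mul _
    have h3 : Measurable fun x => ∫ s, ∑ W ∈ V.powerset, (-1 : ℂ) ^ W.card *
        f (replaceOn W (fun i => X i s) x) ∂P :=
      (StronglyMeasurable.integral_prod_right (ν := P) (f := fun x s => ∑ W ∈ V.powerset,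
        (-1 : ℂ) ^ W.card * f (replaceOn W (fun i => X i s) x)) h2.stronglyMeasurable).measurable
    exact h3.const_mul _
  congr V x y hxy := by
    have h1 : ∀ W ∈ V.powerset, ∀ s,
        replaceOn W (fun i => X i s) x = replaceOn W (fun i => X i s) y := by
      intro W hW s
      ext i
      by_cases hi : i ∈ W
      · simp [replaceOn, hi, hxy i (Finset.mem_powerset.1 hW hi)]
      · simp [replaceOn, hi]
    refine congrArg (fun z => (-1) ^ V.card * z) (integral_congr_ae
      (Filter.Eventually.of_forall fun s => Finset.sum_congr rfl fun W hW => ?_))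
    rw [h1 W hW s]
  norm_le V x := norm_hoeffdingComponent_le hC V x

end Decomposition

/-! ### Moment series of bounded functions of independent variables -/

section MomentSeries

variable {S : Type*} [MeasurableSpace S] {P : Measure S}

lemma momentSeries_eq_integralSeries (W : S → ℂ) :
    momentSeries P W = integralSeries P fun s => PowerSeries.expSeries (W s) := by
  ext r
  rw [coeff_integralSeries, momentSeries, PowerSeries.coeff_mk]
  simp only [PowerSeries.coeff_expSeries]
  rw [integral_div]

variable [IsProbabilityMeasure P]

lemma integral_exp_eq_coeffSum {W : S → ℂ} (hW : Measurable W) {C : ℝ} (hC : ∀ s, ‖W s‖ ≤ C) :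
    ∫ s, Complex.exp (W s) ∂P = PowerSeries.coeffSum (momentSeries P W) := by
  have hbd : ∀ r s, ‖PowerSeries.coeff r (PowerSeries.expSeries (W s))‖ ≤
      C ^ r / (Nat.factorial r : ℝ) := by
    intro r s
    rw [PowerSeries.coeff_expSeries, norm_div, norm_pow, Complex.norm_natCast]
    gcongr
    exact hC s
  have hint : ∀ r, Integrable (fun s => PowerSeries.coeff r (PowerSeries.expSeries (W s))) P := by
    intro r
    refine Integrable.of_bound (Measurable.aestronglyMeasurable ?_) _
      (Filter.Eventually.of_forall (hbd r))
    simp only [PowerSeries.coeff_expSeries]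
    exact (hW.pow_const r).div_const _
  have h := hasSum_integral_of_summable_integral_norm hint
    (Summable.of_nonneg_of_le (fun r => integral_nonneg fun _ => norm_nonneg _) (fun r =>
      (integral_mono (hint r).norm (integrable_const _) (hbd r)).trans (le_of_eq (by simp)))
      (Real.summable_pow_div_factorial C))
  rw [momentSeries_eq_integralSeries, PowerSeries.coeffSum]
  simp only [coeff_integralSeries]
  rw [h.tsum_eq]
  refine integral_congr_ae (Filter.Eventually.of_forall fun s => ?_)
  exact (PowerSeries.hasSum_coeff_expSeries (W s)).tsum_eq.symm

variable {n : ℕ} {Ω : Fin n → Type*} [∀ i, MeasurableSpace (Ω i)] {X : ∀ i, S → Ω i}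
  {f : (∀ i, Ω i) → ℂ}

/-- Up to an additive constant `c`, the cumulant series of `f X` is a power series whose weighted
norm is of order `n` for every admissible scale `R`, and which sums up to `log E exp (f X)`. -/
lemma exists_logOf_momentSeries_eq (hX : ∀ i, Measurable (X i)) (hindep : iIndepFun X P)
    (hf : Measurable f) {C : ℝ} (hC : ∀ x, ‖f x‖ ≤ C) {q : ℕ} {α : ℝ} (hα0 : 0 ≤ α)
    (hα : α ≤ 1 / 100)
    (hS : ∀ t ∈ Finset.Icc 1 (q + 1), ∑ k ∈ Finset.Icc t n,
        Real.exp (3 * α * (k : ℝ) / 2) * 2 ^ t * ((k - 1).choose (t - 1) : ℝ) *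
          maxRowSum P X f k ≤ α) :
    ∃ (c : ℂ) (L : PowerSeries ℂ),
      PowerSeries.constantCoeff L = 0 ∧
      PowerSeries.logOf (momentSeries P fun s => f fun i => X i s) =
        PowerSeries.C c * PowerSeries.X + L ∧
      ∫ s, Complex.exp (f fun i => X i s) ∂P = Complex.exp (c + L.coeffSum) ∧
      ∀ R, 1 ≤ R → 16 * (R * α) ≤ 1 → NormLE R (q + 2) L (n / 19) := by
  classical
  set ν : ∀ i, Measure (Ω i) := fun i => P.map (X i) with hν
  have hνp : ∀ i, IsProbabilityMeasure (ν i) := fun i =>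
    Measure.isProbabilityMeasure_map (hX i).aemeasurable
  have hmap : P.map (fun s i => X i s) = Measure.pi ν :=
    hindep.map_fun_eq_pi_map fun i => (hX i).aemeasurable
  have hXm : Measurable fun s i => X i s := measurable_pi_lambda _ hX
  obtain ⟨s₀⟩ : Nonempty S := nonempty_of_isProbabilityMeasure P
  set x₀ : ∀ i, Ω i := fun i => X i s₀
  have hg := isInteraction_hoeffdingComponent (P := P) hX hf hC
  set g := hoeffdingComponent P X f with hgdef
  set 𝒱 : Finset (Finset (Fin n)) := Finset.univ.erase ∅ with h𝒱def
  have h𝒱 : ∀ W ∈ 𝒱, W.Nonempty := fun W hW =>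
    Finset.nonempty_iff_ne_empty.2 (Finset.mem_erase.1 hW).1
  set c := g ∅ x₀ with hc
  have hdec : ∀ y, f y = c + ∑ V ∈ 𝒱, g V y := by
    intro y
    rw [← sum_hoeffdingComponent (P := P) hX hf hC y, hc, hg.congr ∅ x₀ y (by simp), h𝒱def,
      Finset.add_sum_erase _ (fun V => g V y) (Finset.mem_univ ∅)]
  set Z := partitionSeries ν g 𝒱 Finset.univ x₀ with hZ
  have hmom : momentSeries P (fun s => f fun i => X i s) = PowerSeries.expSeries c * Z := by
    rw [momentSeries_eq_integralSeries, hZ, partitionSeries,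
      mul_integralSeries _ fun r => hg.integrable_coeff 𝒱 _ _ r]
    ext r
    rw [coeff_integralSeries, coeff_integralSeries]
    simp only [replaceOn_univ, ← PowerSeries.expSeries_add, ← hdec]
    rw [← hmap, integral_map hXm.aemeasurable]
    simp only [PowerSeries.coeff_expSeries]
    exact ((hf.pow_const r).div_const _).aestronglyMeasurable
  have hZ1 : PowerSeries.constantCoeff Z = 1 := constantCoeff_partitionSeries ν _ _ _
  have hsmall : ∀ R, 1 ≤ R → 16 * (R * α) ≤ 1 → IsSmall (avgDiff P X f) q α R :=
    fun R hR hRα => isSmall_avgDiff hα0 hα hR hRα hS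
  have hZ0 : Summable fun r => ‖PowerSeries.coeff r Z‖ :=
    Summable.of_nonneg_of_le (fun _ => norm_nonneg _)
      (hg.norm_coeff_partitionSeries_le 𝒱 _ x₀) (Real.summable_pow_div_factorial _)
  have hc0 : Summable fun r => ‖PowerSeries.coeff r (PowerSeries.expSeries c)‖ := by
    simp only [PowerSeries.coeff_expSeries, norm_div, norm_pow, Complex.norm_natCast]
    exact Real.summable_pow_div_factorial _
  refine ⟨c, PowerSeries.logOf Z, PowerSeries.constantCoeff_logOf hZ1, ?_, ?_, ?_⟩
  · rw [hmom, PowerSeries.logOf_mul (PowerSeries.constantCoeff_expSeries c) hZ1,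
      PowerSeries.logOf_expSeries]
  · rw [integral_exp_eq_coeffSum (W := fun s => f fun i => X i s) (hf.comp hXm) fun _ => hC _,
      Complex.exp_add,
      (logOf_partitionSeries hg (hsmall 1 le_rfl (by linarith)) 𝒱 h𝒱 Finset.univ x₀).2]
    rw [hmom, PowerSeries.coeffSum_mul hc0 hZ0]
    congr 1
    exact (PowerSeries.hasSum_coeff_expSeries c).tsum_eq
  · intro R hR hRα
    have h := hsmall R hR hRα
    refine (logOf_partitionSeries hg h 𝒱 h𝒱 Finset.univ x₀).1.mono ?_
    rw [← Finset.mul_sum]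
    linarith [h.sum_weightTop_le h𝒱]

end MomentSeries

/-! ### Cumulants and the remainder -/

/-- A bound that holds for all scales `R ≥ 1` with `16 * R * α ≤ 1` may be used with
`R = 1 / (16 * α)`, which for `α = 0` is read as `R → ∞`. -/
lemma le_of_forall_scale {x C α : ℝ} (hα0 : 0 ≤ α) (hα : α ≤ 1 / 16) {p : ℕ} (hp : p ≠ 0)
    (h : ∀ R, 1 ≤ R → 16 * (R * α) ≤ 1 → x ≤ C / R ^ p) : x ≤ C * (16 * α) ^ p := by
  rcases hα0.eq_or_lt with rfl | hpos
  · have ht : Filter.Tendsto (fun R : ℝ => C / R ^ p) Filter.atTop (nhds 0) :=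
      tendsto_const_nhds.div_atTop (Filter.tendsto_pow_atTop hp)
    have := ge_of_tendsto ht ((Filter.eventually_ge_atTop 1).mono fun R hR => h R hR (by simp))
    simpa [hp] using this
  · have h1 := h (1 / (16 * α)) (by rw [le_div_iff₀ (by positivity)]; linarith)
      (by field_simp; norm_num)
    rw [one_div, inv_pow, div_inv_eq_mul] at h1
    exact h1

lemma sq_mul_le_five_pow {r : ℕ} (hr : 2 ≤ r) : 50 * r ^ 2 ≤ 8 * 5 ^ r := by
  induction r, hr using Nat.le_induction with
  | base => norm_num
  | succ r hr ih =>
    rw [pow_succ 5]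
    nlinarith

theorem theorem1p2 {S : Type*} [MeasurableSpace S] (P : Measure S) [IsProbabilityMeasure P]
    {n : ℕ} {Ω : Fin n → Type*} [∀ i, MeasurableSpace (Ω i)]
    (X : ∀ i, S → Ω i) (hX : ∀ i, Measurable (X i)) (hindep : iIndepFun X P)
    (f : (∀ i, Ω i) → ℂ) (hf : Measurable f) (hbdd : ∃ C : ℝ, ∀ x, ‖f x‖ ≤ C)
    (m : ℕ) (hm : 0 < m) (α : ℝ) (hα0 : 0 ≤ α) (hα : α ≤ 1 / 100)
    (hS : ∀ t ∈ Finset.Icc 1 m,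
      ∑ k ∈ Finset.Icc t n,
        Real.exp (3 * α * (k : ℝ) / 2) * 2 ^ t * ((k - 1).choose (t - 1) : ℝ) *
          maxRowSum P X f k ≤ α) :
    (∃ δ : ℂ, ‖δ‖ ≤ Real.exp ((100 * α) ^ (m + 1)) - 1 ∧
      ∫ s, Complex.exp (f (fun i => X i s)) ∂P =
        (1 + δ) ^ n * Complex.exp (∑ r ∈ Finset.Icc 1 m,
          cumulant P (fun s => f (fun i => X i s)) r / (Nat.factorial r : ℂ))) ∧
    ∀ r : ℕ, 2 ≤ r → r ≤ m →
      ‖cumulant P (fun s => f (fun i => X i s)) r‖ ≤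
        (n : ℝ) * ((Nat.factorial (r - 1) : ℝ) / (50 * (r : ℝ))) * (80 * α) ^ r := by
  obtain ⟨C, hC⟩ := hbdd
  obtain ⟨q, rfl⟩ : ∃ q, m = q + 1 := ⟨m - 1, by omega⟩
  obtain ⟨c, L, hL0, hlog, hexp, hnorm⟩ :=
    exists_logOf_momentSeries_eq hX hindep hf hC hα0 hα hS
  have hcum : ∀ r, cumulant P (fun s => f fun i => X i s) r = (Nat.factorial r : ℂ) *
      PowerSeries.coeff r (PowerSeries.C c * PowerSeries.X + L) := fun r => by
    rw [cumulant, hlog]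
  constructor
  · set rem := L.coeffSum - ∑ r ∈ Finset.range (q + 2), PowerSeries.coeff r L with hrem
    have hremle : ‖rem‖ ≤ n / 19 * (16 * α) ^ (q + 2) :=
      le_of_forall_scale hα0 (by linarith) (by omega) fun R hR hRα =>
        (hnorm R hR hRα).norm_coeffSum_sub_le hR
    have hsum : ∑ r ∈ Finset.Icc 1 (q + 1),
        cumulant P (fun s => f (fun i => X i s)) r / (Nat.factorial r : ℂ) =
        c + ∑ r ∈ Finset.range (q + 2), PowerSeries.coeff r L := by
      have h1 : ∀ r, cumulant P (fun s => f (fun i => X i s)) r / (Nat.factorial r : ℂ) =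
          (if r = 1 then c else 0) + PowerSeries.coeff r L := by
        intro r
        rw [hcum, mul_div_cancel_left₀ _ (by exact_mod_cast Nat.factorial_ne_zero r), map_add,
          PowerSeries.coeff_C_mul, PowerSeries.coeff_X]
        simp
      simp_rw [h1]
      rw [Finset.sum_add_distrib, Finset.sum_ite_eq']
      rw [if_pos (by simp)]
      congr 1
      rw [Finset.range_eq_Ico, Finset.sum_eq_sum_Ico_succ_bot (by omega),
        PowerSeries.coeff_zero_eq_constantCoeff_apply, hL0, zero_add]
      rfl
    refine ⟨Complex.exp (rem / n) - 1, ?_, ?_⟩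
    · have h1 := Complex.norm_exp_sub_sum_le_exp_norm_sub_sum (rem / n) 1
      simp only [Finset.sum_range_one, pow_zero, Nat.factorial_zero, Nat.cast_one, div_one] at h1
      refine h1.trans (sub_le_sub_right (Real.exp_le_exp.2 ?_) _)
      rw [norm_div, Complex.norm_natCast]
      refine div_le_of_le_mul₀ (by positivity) (by positivity) (hremle.trans ?_)
      have h2 : (16 * α) ^ (q + 2) ≤ (100 * α) ^ (q + 1 + 1) := by gcongr; norm_num
      have h3 : (0 : ℝ) ≤ (16 * α) ^ (q + 2) := by positivity
      have h4 : (n : ℝ) / 19 ≤ n := by linarith [Nat.cast_nonneg (α := ℝ) n]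
      rw [mul_comm]
      exact mul_le_mul h2 h4 (by positivity) (by positivity)
    · have h1 : (1 + (Complex.exp (rem / n) - 1)) ^ n = Complex.exp rem := by
        rw [add_sub_cancel, ← Complex.exp_nat_mul]
        rcases Nat.eq_zero_or_pos n with rfl | hn
        · -- For `n = 0` the remainder vanishes.
          have : rem = 0 := by
            rw [← norm_le_zero_iff]
            simpa using hremle
          simp [this]
        · rw [mul_div_cancel₀]
          exact_mod_cast hn.ne'
      rw [h1, hsum, hexp, ← Complex.exp_add, hrem]
      congr 1
      ring
  · intro r hr hrm
    have hcoef : PowerSeries.coeff r (PowerSeries.C c * PowerSeries.X + L) =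
        PowerSeries.coeff r L := by
      rw [map_add, PowerSeries.coeff_C_mul, PowerSeries.coeff_X, if_neg (by omega), mul_zero,
        zero_add]
    have hle : ‖PowerSeries.coeff r L‖ ≤ n / 19 * (16 * α) ^ r :=
      le_of_forall_scale hα0 (by linarith) (by omega) fun R hR hRα => by
        have := (hnorm R hR hRα).coeff_le (by linarith) r
        rw [min_eq_left (by omega)] at this
        rwa [le_div_iff₀ (by positivity), mul_comm]
    rw [hcum, hcoef, norm_mul, Complex.norm_natCast]
    have hfac : (Nat.factorial r : ℝ) = r * (Nat.factorial (r - 1) : ℝ) := by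
      exact_mod_cast (Nat.mul_factorial_pred (by omega)).symm
    have hr0 : (0 : ℝ) < r := by exact_mod_cast (by omega : 0 < r)
    have h5 : 50 * (r : ℝ) ^ 2 ≤ 8 * 5 ^ r := by exact_mod_cast sq_mul_le_five_pow hr
    have h6 : (r : ℝ) / 19 * (16 * α) ^ r ≤ 1 / (50 * r) * (80 * α) ^ r := by
      rw [show 80 * α = 5 * (16 * α) by ring, mul_pow 5, ← mul_assoc]
      refine mul_le_mul_of_nonneg_right ?_ (by positivity)
      rw [div_mul_eq_mul_div, one_mul, div_le_div_iff₀ (by norm_num) (by positivity)]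
      nlinarith [pow_pos (by norm_num : (0 : ℝ) < 5) r]
    calc _ ≤ r * (Nat.factorial (r - 1) : ℝ) * (n / 19 * (16 * α) ^ r) := by
          rw [hfac]
          gcongr
      _ = n * (Nat.factorial (r - 1) : ℝ) * (r / 19 * (16 * α) ^ r) := by ring
      _ ≤ n * (Nat.factorial (r - 1) : ℝ) * (1 / (50 * r) * (80 * α) ^ r) := by gcongr
      _ = _ := by ring
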